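/- **Theorem 7 (momentum-representation form of the actions $\mathcal{A}_{s=0,1,1/2,2}$).** *Setting.* Let $\eta=\operatorname{diag}(1,-1,-1,-1)$ on $\mathbb{R}^4$, $\kappa>0$, and $g_{\mu\nu}=\eta_{\mu\nu}+\kappa h_{\mu\nu}$, where $h_{\mu\nu}=h_{\nu\mu}$ are real Schwartz functions that are small in the sense that $\kappa\sum_\nu|h_{\mu\nu}(x)|<1$ for all $x$ and $\mu$. Let $g^{\mu\nu}$ be the inverse metric, $\sqrt{-g}=\sqrt{-\det(g_{\mu\nu})}$, and let $\mathfrak{e}_\mu{}^\nu$ be the vierbein: $\mathfrak{e}_\mu{}^\alpha\mathfrak{e}_\nu{}^\beta g_{\alpha\beta}=\eta_{\mu\nu}$, $\mathfrak{e}_\mu{}^\alpha\mathfrak{e}_\nu{}^\beta\eta^{\mu\nu}=g^{\alpha\beta}$, in the symmetric gauge ($\mathfrak{e}_\mu{}^\alpha\eta_{\alpha\nu}$ is symmetric) and on the principal branch (all eigenvalues of $\mathfrak{e}_\mu{}^\nu$ have positive real part). Such a vierbein exists. Let $\phi$ be a real scalar field, $A_\mu$ a real covector field, $\psi$ a Dirac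 spinor field (all with Schwartz components), $F_{\mu\nu}=\nabla_\mu A_\nu-\nabla_\nu A_\mu$, $\gamma^\mu$ Dirac matrices ($\{\gamma^\mu,\gamma^\nu\}=2\eta^{\mu\nu}$, $(\gamma^\mu)^\dagger=\gamma^0\gamma^\mu\gamma^0$) and $\bar\psi=\psi^\dagger\gamma^0$. The actions are $$\mathcal{A}_{s=0}=\int d^4x\,\sqrt{-g}\,g^{\mu\nu}\,\tfrac12\,\partial_\mu\phi\,\partial_\nu\phi,\qquad \mathcal{A}_{s=1}=\int d^4x\,\sqrt{-g}\,g^{\mu\nu}g^{\alpha\beta}\left(-\tfrac14 F_{\mu\alpha}F_{\nu\beta}\right),$$ $$\mathcal{A}_{s=1/2}=\int d^4x\,\sqrt{-g}\,\mathfrak{e}_\mu{}^\nu\,\tfrac{i}{2}\left(\bar\psi\gamma^\mu\partial_\nu\psi-\partial_\nu\bar\psi\,\gamma^\mu\psi\right),$$ $$\mathcal{A}_{s=2}=\int d^4x\,\sqrt{-g}\,g^{\mu\nu}g^{\alpha\beta}g^{\rho\sigma}\left[-\tfrac1{2\kappa^2}\left(\partial_\mu g_{\alpha\beta}\partial_\nu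 g_{\rho\sigma}-\partial_\mu g_{\alpha\rho}\partial_\nu g_{\beta\sigma}+2\,\partial_\mu g_{\beta\rho}\partial_\alpha g_{\nu\sigma}-2\,\partial_\mu g_{\nu\alpha}\partial_\beta g_{\rho\sigma}\right)\right].$$ *Momentum representation.* For a field $f$ put $f(p)=\int d^4x\,e^{-ip\cdot x}f(x)$ with $p\cdot x=\eta_{\mu\nu}p^\mu x^\nu$; $h^{(k)}_{\mu\nu}$ and $\bar\psi(p)$ are the transforms of $h_{\mu\nu}(x)$ and $\bar\psi(x)$, and indices of transformed fields and of momenta are moved with $\eta$. *Tensors.* $I^{\mu_1\nu_1\cdots\mu_N\nu_N}$ is $\eta^{\nu_1\mu_2}\eta^{\nu_2\mu_3}\cdots\eta^{\nu_N\mu_1}$ averaged over the $2^N$ choices of exchanging or not exchanging $\mu_i\leftrightarrow\nu_i$ in each pair. $\operatorname{Symm}$ is the average over all permutations of the $n$ pairs $(\rho_i,\sigma_i)$. Put $\mathcal{C}=1$ for $n=0$ and, for $n\ge1$, $$\mathcal{C}^{\rho_1\sigma_1\cdots\rho_n\sigma_n}=\operatorname{Symm}\left[\sum_{m=1}^n\frac{(-1)^{n+m}}{m!\,2^m}\sum_{k_1+\cdots+k_m=n,\;k_i\ge1}\frac{1}{k_1\cdots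 k_m}\left(I_{(k_1)}\cdots I_{(k_m)}\right)^{\rho_1\sigma_1\cdots\rho_n\sigma_n}\right],$$ where $I_{(k)}$ has $k$ index pairs and the pairs are distributed over the factors consecutively in order. In the same way (the factors carrying, in order, $n_0,n_1,\dots$ consecutive pairs of $(\rho_1,\sigma_1),\dots,(\rho_n,\sigma_n)$, all $n_i\ge 0$) $$\mathcal{C}_I^{\mu\nu|\rho_1\cdots\sigma_n}=\operatorname{Symm}\Big[\sum_{n_0+n_1=n}(-1)^{n-n_0}\,\mathcal{C}^{(n_0)}I^{\mu\nu(n_1)}\Big],\qquad \mathcal{C}_{II}^{\mu\nu\alpha\beta|\rho_1\cdots\sigma_n}=\operatorname{Symm}\Big[\sum_{n_0+n_1+n_2=n}(-1)^{n-n_0}\,\mathcal{C}^{(n_0)}I^{\mu\nu(n_1)}I^{\alpha\beta(n_2)}\Big],$$ $$\mathcal{C}_{III}^{\mu\nu\alpha\beta\lambda\tau|\rho_1\cdots\sigma_n}=\operatorname{Symm}\Big[\sum_{n_0+n_1+n_2+n_3=n}(-1)^{n-n_0}\,\mathcal{C}^{(n_0)}I^{\mu\nu(n_1)}I^{\alpha\beta(n_2)}I^{\lambda\tau(n_3)}\Big],\qquad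 \mathcal{C}_E{}_\mu{}^{\nu|\rho_1\cdots\sigma_n}=\operatorname{Symm}\Big[\sum_{n_0+n_1=n}\binom{-1/2}{n_1}\,\mathcal{C}^{(n_0)}I_\mu{}^{\nu(n_1)}\Big].$$ With $I_{\mu\nu\alpha\beta}=\frac12(\eta_{\mu\alpha}\eta_{\nu\beta}+\eta_{\mu\beta}\eta_{\nu\alpha})$, let $$\mathcal{T}^{(\phi)}_{\mu\nu}(p_1,p_2)=-\tfrac12 I_{\mu\nu\alpha\beta}\,p_1^\alpha p_2^\beta,\qquad \mathcal{T}^{(\psi)\mu}{}_\nu(p_1,p_2)=\tfrac12\gamma^\mu(p_1-p_2)_\nu,$$ $$\mathcal{T}^{(A)}_{\mu\nu\alpha\beta|\rho\sigma}(p_1,p_2)=\tfrac14\,p_1^\lambda p_2^\tau\left[I_{\mu\nu\rho\sigma}I_{\alpha\beta\lambda\tau}+I_{\mu\nu\lambda\tau}I_{\alpha\beta\rho\sigma}-I_{\mu\nu\rho\tau}I_{\alpha\beta\sigma\lambda}-I_{\mu\nu\lambda\sigma}I_{\alpha\beta\rho\tau}\right],$$ $$\mathcal{T}^{(h)}_{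\mu\nu\alpha\beta\rho\sigma|\lambda_1\lambda_2\rho_1\sigma_1\rho_2\sigma_2}=-\eta_{\mu\lambda_1}\eta_{\nu\lambda_2}I_{\alpha\beta\rho_1\sigma_1}I_{\rho\sigma\rho_2\sigma_2}+\eta_{\mu\lambda_1}\eta_{\nu\lambda_2}I_{\alpha\rho\rho_1\sigma_1}I_{\beta\sigma\rho_2\sigma_2}-2\,\eta_{\mu\lambda_1}\eta_{\alpha\lambda_2}I_{\beta\rho\rho_1\sigma_1}I_{\nu\sigma\rho_2\sigma_2}+2\,\eta_{\mu\lambda_1}\eta_{\beta\lambda_2}I_{\nu\alpha\rho_1\sigma_1}I_{\rho\sigma\rho_2\sigma_2}.$$ *Claim.* Write $$d\mu_n=\frac{d^4p_1}{(2\pi)^4}\frac{d^4p_2}{(2\pi)^4}\prod_{i=1}^n\frac{d^4k_i}{(2\pi)^4}\,(2\pi)^4\,\delta\Big(p_1+p_2+\sum_{i=1}^nk_i\Big).$$ The integrals defining the four actions converge absolutely, for every $n$ the momentum integrals below converge absolutely, the series over $n$ converge (unconditionally), and $$\mathcal{A}_{s=0}=\sum_{n=0}^\infty\int d\mu_n\,\kappa^n\,\mathcal{T}^{(\phi)}_{\mu\nu}(p_1,p_2)\,\mathcal{C}_I^{\mu\nu|\rho_1\cdots\sigma_n}\,h^{(k_1)}_{\rho_1\sigma_1}\cdots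 h^{(k_n)}_{\rho_n\sigma_n}\,\phi(p_1)\,\phi(p_2),$$ $$\mathcal{A}_{s=1}=\sum_{n=0}^\infty\int d\mu_n\,\kappa^n\,\mathcal{T}^{(A)}_{\mu\nu\alpha\beta|\lambda\tau}(p_1,p_2)\,\mathcal{C}_{II}^{\mu\nu\alpha\beta|\rho_1\cdots\sigma_n}\,h^{(k_1)}_{\rho_1\sigma_1}\cdots h^{(k_n)}_{\rho_n\sigma_n}\,A^\lambda(p_1)\,A^\tau(p_2),$$ $$\mathcal{A}_{s=1/2}=\sum_{n=0}^\infty\int d\mu_n\,\kappa^n\,\mathcal{C}_E{}_\mu{}^{\nu|\rho_1\cdots\sigma_n}\,h^{(k_1)}_{\rho_1\sigma_1}\cdots h^{(k_n)}_{\rho_n\sigma_n}\,\bar\psi(p_1)\,\mathcal{T}^{(\psi)\mu}{}_\nu(p_1,p_2)\,\psi(p_2),$$ $$\mathcal{A}_{s=2}=\sum_{n=0}^\infty\int d\mu_n\,\kappa^n\,\mathcal{C}_{III}^{\mu_1\nu_1\mu_2\nu_2\mu_3\nu_3|\rho_1\cdots\sigma_n}\,h^{(k_1)}_{\rho_1\sigma_1}\cdots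 h^{(k_n)}_{\rho_n\sigma_n}\left(-\tfrac12\right)\mathcal{T}^{(h)}_{\mu_1\nu_1\mu_2\nu_2\mu_3\nu_3|\lambda_1\lambda_2\alpha_1\beta_1\alpha_2\beta_2}\,p_1^{\lambda_1}p_2^{\lambda_2}\,h^{\alpha_1\beta_1}_{(p_1)}h^{\alpha_2\beta_2}_{(p_2)}.$$ -/

import Mathlib

open scoped SchwartzMap ComplexConjugate

noncomputable section

namespace FeynGrav

/-! ### Minkowski space and the metric -/

/-- Lorentz (and also Dirac) indices `0, 1, 2, 3`. -/
abbrev Idx : Type := Fin 4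

/-- Coordinate space `ℝ⁴`, used both for positions `x^μ` and for momenta `p^μ` (upper indices).
Only its Lebesgue measure and its topology matter; Lorentz products use `eta`. -/
abbrev V : Type := EuclideanSpace ℝ (Fin 4)

/-- The flat metric `η = diag(1, -1, -1, -1)`. The matrix is its own inverse, so this is both
`η_{μν}` and `η^{μν}`. -/
def eta : Matrix Idx Idx ℝ := Matrix.diagonal ![1, -1, -1, -1]

/-- `p · x = η_{μν} p^μ x^ν`. -/
def lorentz (p x : V) : ℝ := ∑ μ, ∑ ν, eta μ ν * p μ * x ν

/-- `p_ν = η_{νλ} p^λ`. -/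
def lowerIdx (p : V) (ν : Idx) : ℝ := ∑ l, eta ν l * p l

/-- The partial derivative `∂_μ f` at `x`. -/
def pd {E : Type*} [NormedAddCommGroup E] [NormedSpace ℝ E] (μ : Idx) (f : V → E) (x : V) : E :=
  fderiv ℝ f x (EuclideanSpace.single μ 1)

/-- The metric `g_{μν} = η_{μν} + κ h_{μν}` at `x`. -/
def metric (κ : ℝ) (h : Idx → Idx → 𝓢(V, ℝ)) (x : V) : Matrix Idx Idx ℝ :=
  Matrix.of fun μ ν => eta μ ν + κ * h μ ν x

/-- The inverse metric `g^{μν}` at `x`. -/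
def invMetric (κ : ℝ) (h : Idx → Idx → 𝓢(V, ℝ)) (x : V) : Matrix Idx Idx ℝ :=
  (metric κ h x)⁻¹

/-- `√(-g)` with `g = det g_{μν}`. -/
def sqrtNegDet (κ : ℝ) (h : Idx → Idx → 𝓢(V, ℝ)) (x : V) : ℝ :=
  Real.sqrt (-(metric κ h x).det)

/-- The Christoffel symbols
`Γ^α_{μν} = ½ g^{αβ} (∂_μ g_{βν} + ∂_ν g_{βμ} - ∂_β g_{μν})`. -/
def christoffel (κ : ℝ) (h : Idx → Idx → 𝓢(V, ℝ)) (α μ ν : Idx) (x : V) : ℝ :=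
  (1 / 2) * ∑ β, invMetric κ h x α β *
    (pd μ (fun y => metric κ h y β ν) x + pd ν (fun y => metric κ h y β μ) x
      - pd β (fun y => metric κ h y μ ν) x)

/-- A vierbein `e_μ{}^ν` (first index flat, second index curved) for the metric `η + κ h`: the two
standard normalization conditions, with the local Lorentz freedom fixed in the usual perturbative
way, i.e. `e_{μν} = e_μ{}^α η_{αν}` is symmetric and `e` lies on the principal branch (the one that
is continuously connected to `δ_μ^ν`): its eigenvalues have positive real parts. -/
structure IsVierbein (κ : ℝ) (h : Idx → Idx → 𝓢(V, ℝ)) (e : V → Matrix Idx Idx ℝ) : Prop where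
  flat : ∀ x μ ν, ∑ α, ∑ β, e x μ α * e x ν β * metric κ h x α β = eta μ ν
  curved : ∀ x α β, ∑ μ, ∑ ν, e x μ α * e x ν β * eta μ ν = invMetric κ h x α β
  symmetric : ∀ x, (e x * eta).IsSymm
  principal : ∀ x, ∀ z ∈ spectrum ℂ ((e x).map Complex.ofReal), 0 < z.re

/-! ### Actions in position space -/

/-- `√(-g) · ½ g^{μν} ∂_μφ ∂_νφ`. -/
def scalarLagrangian (κ : ℝ) (h : Idx → Idx → 𝓢(V, ℝ)) (φ : 𝓢(V, ℝ)) (x : V) : ℝ :=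
  sqrtNegDet κ h x * ∑ μ, ∑ ν, invMetric κ h x μ ν * ((1 / 2) * pd μ φ x * pd ν φ x)

/-- `∇_μ A_ν = ∂_μ A_ν - Γ^λ_{μν} A_λ`. -/
def covDeriv (κ : ℝ) (h : Idx → Idx → 𝓢(V, ℝ)) (A : Idx → 𝓢(V, ℝ)) (μ ν : Idx) (x : V) : ℝ :=
  pd μ (A ν) x - ∑ l, christoffel κ h l μ ν x * A l x

/-- `F_{μν} = ∇_μ A_ν - ∇_ν A_μ`. -/
def fieldStrength (κ : ℝ) (h : Idx → Idx → 𝓢(V, ℝ)) (A : Idx → 𝓢(V, ℝ)) (μ ν : Idx) (x : V) : ℝ :=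
  covDeriv κ h A μ ν x - covDeriv κ h A ν μ x

/-- `√(-g) · (-¼) g^{μν} g^{αβ} F_{μα} F_{νβ}`. -/
def vectorLagrangian (κ : ℝ) (h : Idx → Idx → 𝓢(V, ℝ)) (A : Idx → 𝓢(V, ℝ)) (x : V) : ℝ :=
  sqrtNegDet κ h x * ∑ μ, ∑ ν, ∑ α, ∑ β, invMetric κ h x μ ν * invMetric κ h x α β *
    (-(1 / 4) * fieldStrength κ h A μ α x * fieldStrength κ h A ν β x)

/-- `γ` is a system of Dirac matrices: `{γ^μ, γ^ν} = 2 η^{μν}` and `(γ^μ)† = γ^0 γ^μ γ^0`. -/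
structure IsDirac (γ : Idx → Matrix Idx Idx ℂ) : Prop where
  clifford : ∀ μ ν, γ μ * γ ν + γ ν * γ μ = ((2 * eta μ ν : ℝ) : ℂ) • (1 : Matrix Idx Idx ℂ)
  hermitian : ∀ μ, (γ μ).conjTranspose = γ 0 * γ μ * γ 0

/-- The components of the Dirac adjoint `ψ̄ = ψ† γ^0`. -/
def diracBar (γ : Idx → Matrix Idx Idx ℂ) (ψ : Idx → 𝓢(V, ℂ)) (a : Idx) (x : V) : ℂ :=
  ∑ b, conj (ψ b x) * γ 0 b a

/-- `√(-g) e_μ{}^ν · (i/2) (ψ̄ γ^μ ∂_νψ - ∂_νψ̄ γ^μ ψ)`. -/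
def spinorLagrangian (κ : ℝ) (h : Idx → Idx → 𝓢(V, ℝ)) (e : V → Matrix Idx Idx ℝ)
    (γ : Idx → Matrix Idx Idx ℂ) (ψ : Idx → 𝓢(V, ℂ)) (x : V) : ℂ :=
  (sqrtNegDet κ h x : ℂ) * ∑ μ, ∑ ν, (e x μ ν : ℂ) * ((Complex.I / 2) *
    ((∑ a, ∑ b, diracBar γ ψ a x * γ μ a b * pd ν (ψ b) x)
      - ∑ a, ∑ b, pd ν (diracBar γ ψ a) x * γ μ a b * ψ b x))

/-- The Einstein form of the gravitational Lagrangian,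
`√(-g) g^{μν} g^{αβ} g^{ρσ} · (-1/(2κ²)) (∂_μ g_{αβ} ∂_ν g_{ρσ} - ∂_μ g_{αρ} ∂_ν g_{βσ}
  + 2 ∂_μ g_{βρ} ∂_α g_{νσ} - 2 ∂_μ g_{να} ∂_β g_{ρσ})`. -/
def gravityLagrangian (κ : ℝ) (h : Idx → Idx → 𝓢(V, ℝ)) (x : V) : ℝ :=
  let dg : Idx → Idx → Idx → ℝ := fun μ α β => pd μ (fun y => metric κ h y α β) x
  sqrtNegDet κ h x * ∑ μ, ∑ ν, ∑ α, ∑ β, ∑ ρ, ∑ σ,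
    invMetric κ h x μ ν * invMetric κ h x α β * invMetric κ h x ρ σ *
      (-(1 / (2 * κ ^ 2)) *
        (dg μ α β * dg ν ρ σ - dg μ α ρ * dg ν β σ + 2 * dg μ β ρ * dg α ν σ
          - 2 * dg μ ν α * dg β ρ σ))

/-- The action of a massless real scalar field. -/
def scalarAction (κ : ℝ) (h : Idx → Idx → 𝓢(V, ℝ)) (φ : 𝓢(V, ℝ)) : ℝ :=
  ∫ x, scalarLagrangian κ h φ x

/-- The action of a massless vector field. -/
def vectorAction (κ : ℝ) (h : Idx → Idx → 𝓢(V, ℝ)) (A : Idx → 𝓢(V, ℝ)) : ℝ :=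
  ∫ x, vectorLagrangian κ h A x

/-- The action of a massless Dirac field. -/
def spinorAction (κ : ℝ) (h : Idx → Idx → 𝓢(V, ℝ)) (e : V → Matrix Idx Idx ℝ)
    (γ : Idx → Matrix Idx Idx ℂ) (ψ : Idx → 𝓢(V, ℂ)) : ℂ :=
  ∫ x, spinorLagrangian κ h e γ ψ x

/-- The gravitational action in the Einstein parameterization. -/
def gravityAction (κ : ℝ) (h : Idx → Idx → 𝓢(V, ℝ)) : ℝ :=
  ∫ x, gravityLagrangian κ h x

/-! ### The `I` and `C` tensors

A tensor with `n` pairs of indices `(ρ_1, σ_1), …, (ρ_n, σ_n)` is a function of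
`r : Fin n → Idx × Idx`. -/

/-- `η^{ν_1 μ_2} η^{ν_2 μ_3} ⋯ η^{ν_N μ_1}`. -/
def etaCycle {N : ℕ} (r : Fin N → Idx × Idx) : ℝ :=
  ∏ i, eta (r i).2 (r (finRotate N i)).1

/-- `I^{μ_1 ν_1 ⋯ μ_N ν_N}`: the cycle of `η`, symmetrized in each pair `μ_i ↔ ν_i`. -/
def tensorI {N : ℕ} (r : Fin N → Idx × Idx) : ℝ :=
  (1 / 2 ^ N) * ∑ b : Fin N → Bool, etaCycle fun i => if b i then (r i).swap else r i

/-- Symmetrization over all permutations of the index pairs, divided by their number. -/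
def pairSymm {n : ℕ} (T : (Fin n → Idx × Idx) → ℝ) (r : Fin n → Idx × Idx) : ℝ :=
  (1 / (n.factorial : ℝ)) * ∑ s : Equiv.Perm (Fin n), T (r ∘ s)

/-- `C^{μ_1 ν_1 ⋯ μ_n ν_n}`: the symmetrization of
`∑_m (-1)^{n+m} / (m! 2^m) ∑_{k_1 + ⋯ + k_m = n} 1 / (k_1 ⋯ k_m) I_{(k_1)} ⋯ I_{(k_m)}`, where the
`k_i` are positive and the `i`-th factor carries the `i`-th block of consecutive index pairs.
The pair of sums is one sum over the compositions of `n`. For `n = 0` there is only the empty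
composition (`m = 0`), which gives the background value `1`. -/
def tensorC {n : ℕ} : (Fin n → Idx × Idx) → ℝ :=
  pairSymm fun r => ∑ c : Composition n,
    (-1) ^ (n + c.length) / ((c.length.factorial : ℝ) * 2 ^ c.length) *
      ∏ i : Fin c.length, (1 / (c.blocksFun i : ℝ)) * tensorI fun j => r (c.embedding i j)

/-- The `len` consecutive index pairs of `r` that follow the first `start` ones
(only used with `start + len ≤ n`). -/
def slice {n : ℕ} (r : Fin n → Idx × Idx) (start len : ℕ) : Fin len → Idx × Idx :=
  fun j => if hj : start + j < n then r ⟨start + j, hj⟩ else (0, 0)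

/-- The tensor `I^{μν ρ_1 σ_1 ⋯ ρ_k σ_k}` with its first pair singled out. -/
def tensorI' (μ ν : Idx) {k : ℕ} (r : Fin k → Idx × Idx) : ℝ :=
  tensorI (Fin.cons (μ, ν) r : Fin (k + 1) → Idx × Idx)

/-- `C_I^{μν|ρ_1 σ_1 ⋯ ρ_n σ_n}`. -/
def tensorCI (μ ν : Idx) {n : ℕ} : (Fin n → Idx × Idx) → ℝ :=
  pairSymm fun r => ∑ k ∈ Finset.Nat.antidiagonalTuple 2 n,
    (-1) ^ (n - k 0) * tensorC (slice r 0 (k 0)) * tensorI' μ ν (slice r (k 0) (k 1))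

/-- `C_II^{μναβ|ρ_1 σ_1 ⋯ ρ_n σ_n}`. -/
def tensorCII (μ ν α β : Idx) {n : ℕ} : (Fin n → Idx × Idx) → ℝ :=
  pairSymm fun r => ∑ k ∈ Finset.Nat.antidiagonalTuple 3 n,
    (-1) ^ (n - k 0) * tensorC (slice r 0 (k 0)) * tensorI' μ ν (slice r (k 0) (k 1)) *
      tensorI' α β (slice r (k 0 + k 1) (k 2))

/-- `C_III^{μναβλτ|ρ_1 σ_1 ⋯ ρ_n σ_n}`. -/
def tensorCIII (μ ν α β l τ : Idx) {n : ℕ} : (Fin n → Idx × Idx) → ℝ :=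
  pairSymm fun r => ∑ k ∈ Finset.Nat.antidiagonalTuple 4 n,
    (-1) ^ (n - k 0) * tensorC (slice r 0 (k 0)) * tensorI' μ ν (slice r (k 0) (k 1)) *
      tensorI' α β (slice r (k 0 + k 1) (k 2)) * tensorI' l τ (slice r (k 0 + k 1 + k 2) (k 3))

/-- `C_E{}_μ{}^{ν|ρ_1 σ_1 ⋯ ρ_n σ_n}`, with the generalized binomial coefficient `(-1/2 choose n_1)`
and the index `μ` lowered by `η`. -/
def tensorCE (μ ν : Idx) {n : ℕ} : (Fin n → Idx × Idx) → ℝ :=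
  pairSymm fun r => ∑ k ∈ Finset.Nat.antidiagonalTuple 2 n,
    Ring.choose (-(1 / 2) : ℝ) (k 1) * tensorC (slice r 0 (k 0)) *
      ∑ l, eta μ l * tensorI' l ν (slice r (k 0) (k 1))

/-! ### The derivative tensors -/

/-- `I_{μναβ} = ½ (η_{μα} η_{νβ} + η_{μβ} η_{να})`. -/
def idI (μ ν α β : Idx) : ℝ := (1 / 2) * (eta μ α * eta ν β + eta μ β * eta ν α)

/-- `T^{(φ)}_{μν}(p_1, p_2) = -½ I_{μναβ} p_1^α p_2^β`. -/
def tensorTphi (μ ν : Idx) (p₁ p₂ : V) : ℝ :=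
  -(1 / 2) * ∑ α, ∑ β, idI μ ν α β * p₁ α * p₂ β

/-- `T^{(A)}_{μναβ|ρσ}(p_1, p_2)`. -/
def tensorTA (μ ν α β ρ σ : Idx) (p₁ p₂ : V) : ℝ :=
  (1 / 4) * ∑ l, ∑ τ, p₁ l * p₂ τ *
    (idI μ ν ρ σ * idI α β l τ + idI μ ν l τ * idI α β ρ σ
      - idI μ ν ρ τ * idI α β σ l - idI μ ν l σ * idI α β ρ τ)

/-- `T^{(ψ)μ}{}_ν(p_1, p_2) = ½ γ^μ (p_1 - p_2)_ν`. -/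
def tensorTpsi (γ : Idx → Matrix Idx Idx ℂ) (μ ν : Idx) (p₁ p₂ : V) : Matrix Idx Idx ℂ :=
  ((1 / 2 * lowerIdx (p₁ - p₂) ν : ℝ) : ℂ) • γ μ

/-- `T^{(h)}_{μναβρσ|λ_1 λ_2 ρ_1 σ_1 ρ_2 σ_2}`. -/
def tensorTh (μ ν α β ρ σ l₁ l₂ ρ₁ σ₁ ρ₂ σ₂ : Idx) : ℝ :=
  -(eta μ l₁ * eta ν l₂ * idI α β ρ₁ σ₁ * idI ρ σ ρ₂ σ₂)
    + eta μ l₁ * eta ν l₂ * idI α ρ ρ₁ σ₁ * idI β σ ρ₂ σ₂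
    - 2 * (eta μ l₁ * eta α l₂ * idI β ρ ρ₁ σ₁ * idI ν σ ρ₂ σ₂)
    + 2 * (eta μ l₁ * eta β l₂ * idI ν α ρ₁ σ₁ * idI ρ σ ρ₂ σ₂)

/-! ### Momentum representation -/

/-- The momentum representation `f(p) = ∫ d⁴x e^{-i p·x} f(x)`, so that
`f(x) = ∫ d⁴p/(2π)⁴ e^{i p·x} f(p)`. -/
def momRep (f : V → ℂ) (p : V) : ℂ :=
  ∫ x, Complex.exp (-(Complex.I * (lorentz p x : ℂ))) * f x

/-- `h_{ρσ}^{(k)}`. -/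
def hMom (h : Idx → Idx → 𝓢(V, ℝ)) (ρ σ : Idx) (k : V) : ℂ :=
  momRep (fun x => (h ρ σ x : ℂ)) k

/-- `h^{ρσ}_{(k)} = η^{ρα} η^{σβ} h_{αβ}^{(k)}`. -/
def hMomUp (h : Idx → Idx → 𝓢(V, ℝ)) (ρ σ : Idx) (k : V) : ℂ :=
  ∑ α, ∑ β, (eta ρ α * eta σ β : ℝ) * hMom h α β k

/-- `A^ρ(p) = η^{ρσ} A_σ(p)`. -/
def aMomUp (A : Idx → 𝓢(V, ℝ)) (ρ : Idx) (p : V) : ℂ :=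
  ∑ σ, (eta ρ σ : ℂ) * momRep (fun x => (A σ x : ℂ)) p

/-- Momenta `(p_1, p_2, (k_1, …, k_n))`. -/
abbrev Momenta (n : ℕ) : Type := V × V × (Fin n → V)

/-- The measure `δ(p_1 + p_2 + ∑ k_i) d⁴p_1 d⁴p_2 ∏ d⁴k_i`: for fixed `p_1` and `k`, the factor
`δ(p_1 + p_2 + ∑ k_i) d⁴p_2` is the unit mass at `p_2 = -(p_1 + ∑ k_i)`. -/
def deltaMeasure (n : ℕ) : MeasureTheory.Measure (Momenta n) :=
  (MeasureTheory.volume : MeasureTheory.Measure (V × (Fin n → V))).map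
    fun q => (q.1, -(q.1 + ∑ i, q.2 i), q.2)

/-- The measure `d⁴p_1/(2π)⁴ d⁴p_2/(2π)⁴ ∏ d⁴k_i/(2π)⁴ (2π)⁴ δ(p_1 + p_2 + ∑ k_i)`. -/
def momMeasure (n : ℕ) : MeasureTheory.Measure (Momenta n) :=
  ENNReal.ofReal ((1 / (2 * Real.pi) ^ 4) ^ (n + 2) * (2 * Real.pi) ^ 4) • deltaMeasure n

/-- `h_{ρ_1 σ_1}^{(k_1)} ⋯ h_{ρ_n σ_n}^{(k_n)}`. -/
def gravitons (h : Idx → Idx → 𝓢(V, ℝ)) {n : ℕ} (r : Fin n → Idx × Idx) (k : Fin n → V) : ℂ :=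
  ∏ i, hMom h (r i).1 (r i).2 (k i)

/-- `κ^n T^{(φ)}_{μν}(p_1, p_2) C_I^{μν|ρ_1 ⋯ σ_n} h_{ρ_1 σ_1} ⋯ h_{ρ_n σ_n} φ(p_1) φ(p_2)`. -/
def scalarTerm (κ : ℝ) (h : Idx → Idx → 𝓢(V, ℝ)) (φ : 𝓢(V, ℝ)) (n : ℕ) (q : Momenta n) : ℂ :=
  (κ : ℂ) ^ n * ∑ μ, ∑ ν, ∑ r : Fin n → Idx × Idx,
    (tensorTphi μ ν q.1 q.2.1 : ℂ) * (tensorCI μ ν r : ℂ) * gravitons h r q.2.2 *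
      momRep (fun x => (φ x : ℂ)) q.1 * momRep (fun x => (φ x : ℂ)) q.2.1

/-- `κ^n T^{(A)}_{μναβ|λτ}(p_1, p_2) C_II^{μναβ|ρ_1 ⋯ σ_n} h_{ρ_1 σ_1} ⋯ h_{ρ_n σ_n}
A^λ(p_1) A^τ(p_2)`. -/
def vectorTerm (κ : ℝ) (h : Idx → Idx → 𝓢(V, ℝ)) (A : Idx → 𝓢(V, ℝ)) (n : ℕ)
    (q : Momenta n) : ℂ :=
  (κ : ℂ) ^ n * ∑ μ, ∑ ν, ∑ α, ∑ β, ∑ l, ∑ τ, ∑ r : Fin n → Idx × Idx,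
    (tensorTA μ ν α β l τ q.1 q.2.1 : ℂ) * (tensorCII μ ν α β r : ℂ) * gravitons h r q.2.2 *
      aMomUp A l q.1 * aMomUp A τ q.2.1

/-- `κ^n C_E{}_μ{}^{ν|ρ_1 ⋯ σ_n} h_{ρ_1 σ_1} ⋯ h_{ρ_n σ_n} ψ̄(p_1) T^{(ψ)μ}{}_ν(p_1, p_2) ψ(p_2)`,
where `ψ̄(p)` is the momentum representation of `ψ̄(x)`. -/
def spinorTerm (κ : ℝ) (h : Idx → Idx → 𝓢(V, ℝ)) (γ : Idx → Matrix Idx Idx ℂ)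
    (ψ : Idx → 𝓢(V, ℂ)) (n : ℕ) (q : Momenta n) : ℂ :=
  (κ : ℂ) ^ n * ∑ μ, ∑ ν, ∑ r : Fin n → Idx × Idx,
    (tensorCE μ ν r : ℂ) * gravitons h r q.2.2 *
      ∑ a, ∑ b, momRep (diracBar γ ψ a) q.1 * tensorTpsi γ μ ν q.1 q.2.1 a b *
        momRep (ψ b) q.2.1

/-- `κ^n C_III^{μ_1 ν_1 μ_2 ν_2 μ_3 ν_3|ρ_1 ⋯ σ_n} h_{ρ_1 σ_1} ⋯ h_{ρ_n σ_n} · (-½)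
T^{(h)}_{μ_1 ν_1 μ_2 ν_2 μ_3 ν_3|λ_1 λ_2 α_1 β_1 α_2 β_2} p_1^{λ_1} p_2^{λ_2}
h^{α_1 β_1}_{(p_1)} h^{α_2 β_2}_{(p_2)}`. The factor `-½` is the one in front of the bracket
`∂h ∂h - ∂h ∂h + 2 ∂h ∂h - 2 ∂h ∂h` of the action, which `T^{(h)}` does not contain. -/
def gravityTerm (κ : ℝ) (h : Idx → Idx → 𝓢(V, ℝ)) (n : ℕ) (q : Momenta n) : ℂ :=
  (κ : ℂ) ^ n * ∑ μ₁, ∑ ν₁, ∑ μ₂, ∑ ν₂, ∑ μ₃, ∑ ν₃,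
    ∑ l₁, ∑ l₂, ∑ α₁, ∑ β₁, ∑ α₂, ∑ β₂, ∑ r : Fin n → Idx × Idx,
    (tensorCIII μ₁ ν₁ μ₂ ν₂ μ₃ ν₃ r : ℂ) * gravitons h r q.2.2 *
      (-(1 / 2) * (tensorTh μ₁ ν₁ μ₂ ν₂ μ₃ ν₃ l₁ l₂ α₁ β₁ α₂ β₂ : ℂ)) *
      (q.1 l₁ : ℂ) * (q.2.1 l₂ : ℂ) * hMomUp h α₁ β₁ q.1 * hMomUp h α₂ β₂ q.2.1

end FeynGrav

end

open FeynGrav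
open scoped SchwartzMap

/-!
# Why the momentum-space expansions hold

Fix a point `x` and let `w = κ h(x)`, `X = w η`, so that `g = η + w = (1 + X) η`. The smallness
hypothesis says that `X` has operator norm below one for the sup norm on `ℝ⁴` (maximal absolute row
sum), and since Schwartz functions vanish at infinity one bound `θ < 1` serves all points
(`exists_uniform_bound`). Every metric quantity in the Lagrangians is then a power series in `X`:

* `√(-g) = √(det (1 + X)) = exp (∑ (-1)^(k+1) tr X^k / (2k))` (`exp_tsum_trace_pow`,
  `sqrt_neg_det_eta_add`),
* `g⁻¹ = η ∑ (-X)^k` (`hasSum_inv_eta_add`),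
* the vierbein is `∑ (-1/2 choose k) X^k`: this binomial series is a square root of `(1 + X)⁻¹` whose
  spectrum lies in the right half plane, and there is only one (`eq_invSqrtOneAdd`).

Contracting the tensors of the expansion with copies of the symmetric matrix `w` removes all
symmetrizations: `I_(k)` becomes `tr X^k` or `(η X^k)^{μν}`, the tensor `C` becomes the `n`-th
coefficient of the exponential, as a sum over the compositions of `n` (`contr_tensorC`), and
`C_I`, `C_II`, `C_III`, `C_E` become the coefficients of Cauchy products with this exponential
(`contr_tensorCI`, …, `contr_tensorCE`). These coefficients are dominated, uniformly in `x`, by those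
of the same product formed from `θ` (the structure `Resums`).

So each Lagrangian is an absolutely dominated series of products of Schwartz functions. Dominated
convergence allows integration term by term, and the integral of a product of Schwartz functions is
the integral of the product of their transforms against `d⁴p₁ d⁴p₂ ∏ d⁴kᵢ δ(p₁ + p₂ + ∑ kᵢ)` by
Fourier inversion (`integral_momMeasure_prod`). This is `Resums.expands`. What is left is algebra:
derivatives become momenta, the Christoffel symbols cancel in `F`, and the index symmetries of the
`C` tensors absorb the symmetrizations in the vertices `T`.
-/

namespace FeynGrav

/-! ### Series indexed by tuples and compositions -/

/-- The product of `m` absolutely convergent series, summed over `m`-tuples of indices. -/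
theorem hasSum_prod_tuple (m : ℕ) (f : Fin m → ℕ → ℝ) (hf : ∀ i, Summable fun k => ‖f i k‖) :
    (Summable fun k : Fin m → ℕ => ‖∏ i, f i (k i)‖) ∧
      HasSum (fun k : Fin m → ℕ => ∏ i, f i (k i)) (∏ i, ∑' j, f i j) := by
  induction m with
  | zero =>
    refine ⟨Summable.of_finite, ?_⟩
    simp
  | succ m ih =>
    obtain ⟨h1, h2⟩ := ih (fun i => f i.succ) fun i => hf _
    let g : (Fin m → ℕ) → ℝ := fun k => ∏ i : Fin m, f i.succ (k i)
    have key : ∀ p : ℕ × (Fin m → ℕ), (∏ i, f i (Fin.consEquiv (fun _ => ℕ) p i)) =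
        f 0 p.1 * g p.2 := fun p => by
      rw [Fin.prod_univ_succ]; rfl
    have hs : Summable fun p : ℕ × (Fin m → ℕ) => ‖f 0 p.1 * g p.2‖ :=
      Summable.mul_norm (hf 0) h1
    have h3 : HasSum (fun p : ℕ × (Fin m → ℕ) => f 0 p.1 * g p.2)
        ((∑' j, f 0 j) * ∏ i : Fin m, ∑' j, f i.succ j) :=
      (hf 0).of_norm.hasSum.mul h2 hs.of_norm
    refine ⟨?_, ?_⟩
    · rw [← (Fin.consEquiv fun _ => ℕ).summable_iff]
      refine hs.congr fun p => ?_
      rw [Function.comp_apply, key]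
    · rw [← (Fin.consEquiv fun _ => ℕ).hasSum_iff, Fin.prod_univ_succ]
      refine h3.congr_fun fun p => ?_
      rw [Function.comp_apply, key]

/-- The Cauchy product of `m` absolutely convergent series. -/
theorem hasSum_antidiagonalTuple {m : ℕ} (f : Fin m → ℕ → ℝ)
    (hf : ∀ i, Summable fun k => ‖f i k‖) :
    HasSum (fun n => ∑ k ∈ Finset.Nat.antidiagonalTuple m n, ∏ i, f i (k i))
      (∏ i, ∑' j, f i j) := by
  have h := (hasSum_prod_tuple m f hf).2
  rw [← (Finset.Nat.sigmaAntidiagonalTupleEquivTuple m).hasSum_iff] at h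
  refine (h.sigma fun n => hasSum_fintype _).congr_fun ?_
  intro n
  rw [← Finset.sum_coe_sort]
  rfl

theorem abs_sum_antidiagonalTuple_le {m : ℕ} {f g : Fin m → ℕ → ℝ}
    (hfg : ∀ i k, |f i k| ≤ g i k) (n : ℕ) :
    |∑ k ∈ Finset.Nat.antidiagonalTuple m n, ∏ i, f i (k i)| ≤
      ∑ k ∈ Finset.Nat.antidiagonalTuple m n, ∏ i, g i (k i) := by
  refine (Finset.abs_sum_le_sum_abs _ _).trans (Finset.sum_le_sum fun k _ => ?_)
  rw [Finset.abs_prod]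
  exact Finset.prod_le_prod (fun _ _ => abs_nonneg _) fun i _ => hfg i _

/-- The `n`-th coefficient of `exp (∑_{k ≥ 1} a_k t^k)`, as a sum over the compositions of `n`. -/
noncomputable def expCoeff (a : ℕ → ℝ) (n : ℕ) : ℝ :=
  ∑ c : Composition n, 1 / (c.length.factorial : ℝ) * ∏ i, a (c.blocksFun i)

theorem abs_expCoeff_le {a b : ℕ → ℝ} (hab : ∀ k, |a k| ≤ b k) (n : ℕ) :
    |expCoeff a n| ≤ expCoeff b n := by
  refine (Finset.abs_sum_le_sum_abs _ _).trans (Finset.sum_le_sum fun c _ => ?_)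
  rw [abs_mul, Finset.abs_prod, abs_of_nonneg (by positivity : (0 : ℝ) ≤ 1 / c.length.factorial)]
  exact mul_le_mul_of_nonneg_left
    (Finset.prod_le_prod (fun _ _ => abs_nonneg _) fun i _ => hab _) (by positivity)

/-- A composition of some `n` into `m` blocks is the same as an `m`-tuple of natural numbers, the
block sizes minus one. -/
def compositionToTuple : (Σ n, Composition n) → Σ m, (Fin m → ℕ) :=
  fun c => ⟨c.2.length, fun i => c.2.blocksFun i - 1⟩

theorem compositionToTuple_bijective : Function.Bijective compositionToTuple := by
  have hb : ∀ c : Σ n, Composition n,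
      c.2.blocks = List.ofFn fun i => (compositionToTuple c).2 i + 1 := by
    rintro ⟨n, c⟩
    have h1 : (fun i => (compositionToTuple ⟨n, c⟩).2 i + 1) = c.blocksFun := by
      funext i
      exact Nat.sub_add_cancel (c.one_le_blocksFun i)
    rw [h1]
    exact c.ofFn_blocksFun.symm
  constructor
  · rintro c d hcd
    have h : c.2.blocks = d.2.blocks := by rw [hb c, hb d, hcd]
    rcases c with ⟨n, c⟩
    rcases d with ⟨m, d⟩
    obtain rfl : n = m := by rw [← c.blocks_sum, ← d.blocks_sum]; exact congrArg List.sum h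
    simp only [Sigma.mk.injEq, heq_eq_eq, true_and]
    exact Composition.ext h
  · rintro ⟨m, k⟩
    let c : Composition (List.ofFn fun i => k i + 1).sum :=
      { blocks := List.ofFn fun i => k i + 1
        blocks_pos := by
          intro i hi
          rw [List.mem_ofFn] at hi
          obtain ⟨j, rfl⟩ := hi
          exact Nat.succ_pos _
        blocks_sum := rfl }
    refine ⟨⟨_, c⟩, ?_⟩
    have h := hb ⟨_, c⟩
    change (List.ofFn fun i => k i + 1) = _ at h
    rw [List.ofFn_inj'] at h
    have h2 := congrArg
      (fun s : Σ m, (Fin m → ℕ) => (⟨s.1, fun i => s.2 i - 1⟩ : Σ m, (Fin m → ℕ))) h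
    simpa using h2.symm

/-- Expanding `exp s = ∑ s^m / m!` with `s = ∑_{k ≥ 1} a_k` and sorting the terms by total weight, the
terms of weight `n` are indexed by the compositions of `n`. -/
theorem hasSum_expCoeff {a : ℕ → ℝ} (ha : Summable fun k => ‖a (k + 1)‖) :
    HasSum (expCoeff a) (Real.exp (∑' k, a (k + 1))) := by
  let F : (Σ m, (Fin m → ℕ)) → ℝ := fun s => 1 / (s.1.factorial : ℝ) * ∏ i, a (s.2 i + 1)
  have hm : ∀ m, HasSum (fun k : Fin m → ℕ => F ⟨m, k⟩)
      (1 / (m.factorial : ℝ) * (∑' k, a (k + 1)) ^ m) := fun m => by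
    simpa [F] using ((hasSum_prod_tuple m (fun _ k => a (k + 1)) fun _ => ha).2.mul_left
      (1 / (m.factorial : ℝ)))
  have hm' : ∀ m, HasSum (fun k : Fin m → ℕ => ‖F ⟨m, k⟩‖)
      (1 / (m.factorial : ℝ) * (∑' k, ‖a (k + 1)‖) ^ m) := fun m => by
    have := ((hasSum_prod_tuple m (fun _ k => ‖a (k + 1)‖) fun _ => by simpa using ha).2.mul_left
      (1 / (m.factorial : ℝ)))
    simpa [F] using this
  have hexp : ∀ s : ℝ, HasSum (fun m : ℕ => 1 / (m.factorial : ℝ) * s ^ m) (Real.exp s) := fun s => by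
    rw [Real.exp_eq_exp_ℝ]
    simpa [div_eq_inv_mul] using NormedSpace.expSeries_div_hasSum_exp (𝔸 := ℝ) s
  have hsum : Summable F := by
    refine Summable.of_norm ((summable_sigma_of_nonneg fun _ => norm_nonneg _).2
      ⟨fun m => (hm' m).summable, ?_⟩)
    simpa only [fun m => (hm' m).tsum_eq] using (hexp (∑' k, ‖a (k + 1)‖)).summable
  have hF : HasSum F (Real.exp (∑' k, a (k + 1))) := by
    have h := hsum.hasSum.sigma hm
    rw [← h.unique (hexp _)]
    exact hsum.hasSum
  rw [← (Equiv.ofBijective _ compositionToTuple_bijective).hasSum_iff] at hF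
  have hc : ∀ c : Σ n, Composition n, F (compositionToTuple c) =
      1 / (c.2.length.factorial : ℝ) * ∏ i, a (c.2.blocksFun i) := fun c => by
    simp only [F, compositionToTuple]
    congr 1
    refine Finset.prod_congr rfl fun i _ => ?_
    rw [Nat.sub_add_cancel (c.2.one_le_blocksFun i)]
  refine (hF.sigma fun n => hasSum_fintype _).congr_fun ?_
  intro n
  exact Finset.sum_congr rfl fun c _ => (hc ⟨n, c⟩).symm

section Contraction

/-! ### Contraction with a symmetric matrix -/

/-- The contraction `T^{ρ_1 σ_1 ⋯ ρ_n σ_n} w_{ρ_1 σ_1} ⋯ w_{ρ_n σ_n}`. -/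
noncomputable def contr (w : Matrix Idx Idx ℝ) {n : ℕ} (T : (Fin n → Idx × Idx) → ℝ) : ℝ :=
  ∑ r, T r * ∏ i, w (r i).1 (r i).2

variable {w : Matrix Idx Idx ℝ}

theorem contr_const_mul {n : ℕ} (a : ℝ) (T : (Fin n → Idx × Idx) → ℝ) :
    contr w (fun r => a * T r) = a * contr w T := by
  simp only [contr, Finset.mul_sum, mul_assoc]

theorem contr_sum {ι : Type*} (s : Finset ι) {n : ℕ} (T : ι → (Fin n → Idx × Idx) → ℝ) :
    contr w (fun r => ∑ i ∈ s, T i r) = ∑ i ∈ s, contr w (T i) := by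
  simp only [contr, Finset.sum_mul]
  rw [Finset.sum_comm]

/-- Contraction with copies of one matrix does not see the order of the index pairs. -/
theorem contr_pairSymm {n : ℕ} (T : (Fin n → Idx × Idx) → ℝ) :
    contr w (pairSymm T) = contr w T := by
  have h : ∀ s : Equiv.Perm (Fin n), contr w (fun r => T (r ∘ s)) = contr w T := fun s => by
    unfold contr
    refine Fintype.sum_equiv (Equiv.arrowCongr s.symm (Equiv.refl _)) _ _ fun r => ?_
    have : ∏ i, w (r i).1 (r i).2 = ∏ i, w (r (s i)).1 (r (s i)).2 :=
      (Equiv.prod_comp s fun i => w (r i).1 (r i).2).symm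
    rw [this]
    rfl
  unfold pairSymm
  rw [contr_const_mul, contr_sum, Finset.sum_congr rfl fun s _ => h s]
  have : (n.factorial : ℝ) ≠ 0 := by positivity
  simp [Fintype.card_perm, this]

theorem slice_slice {n : ℕ} (r : Fin n → Idx × Idx) {a b s l : ℕ} (h : s + l ≤ b) :
    slice (slice r a b) s l = slice r (a + s) l := by
  funext j
  have hj := j.2
  have : s + (j : ℕ) < b := by omega
  simp [slice, this, add_assoc]

/-- Contraction is multiplicative over a split of the index pairs into two consecutive groups. -/
theorem contr_slice_mul {n a b : ℕ} (hab : a + b = n) (F : (Fin a → Idx × Idx) → ℝ)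
    (G : (Fin b → Idx × Idx) → ℝ) :
    contr w (fun r : Fin n → Idx × Idx => F (slice r 0 a) * G (slice r a b)) =
      contr w F * contr w G := by
  subst hab
  unfold contr
  rw [← Equiv.sum_comp (Fin.appendEquiv a b), Fintype.sum_prod_type, Finset.sum_mul_sum]
  refine Finset.sum_congr rfl fun u _ => Finset.sum_congr rfl fun v _ => ?_
  have h1 : slice (Fin.append u v) 0 a = u := by
    funext j
    have : (j : ℕ) < a + b := by omega
    have e : (⟨j, this⟩ : Fin (a + b)) = Fin.castAdd b j := rfl
    simp [slice, this, e]
  have h2 : slice (Fin.append u v) a b = v := by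
    funext j
    have e : (⟨a + j, by omega⟩ : Fin (a + b)) = Fin.natAdd a j := rfl
    simp [slice, e]
  simp only [Fin.appendEquiv, Equiv.coe_fn_mk]
  rw [h1, h2, Fin.prod_univ_add]
  simp only [Fin.append_left, Fin.append_right]
  ring

/-- Contraction is multiplicative over a split of the index pairs into the blocks of a composition. -/
theorem contr_composition {n : ℕ} (c : Composition n)
    (T : ∀ i : Fin c.length, (Fin (c.blocksFun i) → Idx × Idx) → ℝ) :
    contr w (fun r => ∏ i, T i fun j => r (c.embedding i j)) = ∏ i, contr w (T i) := by
  unfold contr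
  rw [Finset.prod_univ_sum, Fintype.piFinset_univ]
  symm
  refine Fintype.sum_equiv ((Equiv.piCurry fun _ _ => Idx × Idx).symm.trans
    (Equiv.arrowCongr c.blocksFinEquiv (Equiv.refl _))) _ _ fun r => ?_
  have hr : ∀ (i : Fin c.length) (j : Fin (c.blocksFun i)),
      ((Equiv.piCurry fun _ _ => Idx × Idx).symm.trans
        (Equiv.arrowCongr c.blocksFinEquiv (Equiv.refl _))) r (c.embedding i j) = r i j := by
    intro i j
    have : c.blocksFinEquiv.symm (c.embedding i j) = ⟨i, j⟩ := by
      rw [Equiv.symm_apply_eq]; rfl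
    simp only [Equiv.trans_apply, Equiv.arrowCongr_apply, Function.comp_apply, this]
    rfl
  rw [← Equiv.prod_comp c.blocksFinEquiv, Fintype.prod_sigma, ← Finset.prod_mul_distrib]
  refine Finset.prod_congr rfl fun i _ => ?_
  have e : ∀ j, c.blocksFinEquiv ⟨i, j⟩ = c.embedding i j := fun _ => rfl
  simp only [e, hr]

/-! ### The contracted `I` tensors -/

/-- Contraction with a symmetric matrix does not see exchanges within the index pairs. -/
theorem contr_swap (hw : w.IsSymm) {n : ℕ} (b : Fin n → Bool) (T : (Fin n → Idx × Idx) → ℝ) :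
    contr w (fun r => T fun i => if b i then (r i).swap else r i) = contr w T := by
  unfold contr
  refine Fintype.sum_equiv
    (Equiv.piCongrRight fun i => if b i then Equiv.prodComm Idx Idx else Equiv.refl _) _ _
    fun r => ?_
  have e : ∀ i, (Equiv.piCongrRight fun i => if b i then Equiv.prodComm Idx Idx else Equiv.refl _)
      r i = if b i then (r i).swap else r i := fun i => by
    rw [Equiv.piCongrRight_apply, Pi.map_apply]
    split <;> rfl
  refine congrArg₂ _ (congrArg T (funext fun i => (e i).symm)) ?_
  refine Finset.prod_congr rfl fun i _ => ?_
  rw [e]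
  split
  · exact (hw.apply _ _).symm
  · rfl

/-- The open chain `η^{ν ρ_1} η^{σ_1 ρ_2} ⋯ η^{σ_k μ}`. -/
noncomputable def etaChain : ∀ {k : ℕ}, (Fin k → Idx × Idx) → Idx → Idx → ℝ
  | 0, _, ν, μ => eta ν μ
  | _ + 1, r, ν, μ => eta ν (r 0).1 * etaChain (Fin.tail r) (r 0).2 μ

theorem prod_etaChain {k : ℕ} (p : Idx × Idx) (r : Fin k → Idx × Idx) (μ : Idx) :
    (∏ i : Fin k, eta ((Fin.cons p r : Fin (k + 1) → Idx × Idx) i.castSucc).2 (r i).1) *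
      eta ((Fin.cons p r : Fin (k + 1) → Idx × Idx) (Fin.last k)).2 μ = etaChain r p.2 μ := by
  induction k generalizing p with
  | zero => simp [etaChain]
  | succ k ih =>
    rw [etaChain, ← ih (r 0) (Fin.tail r), Fin.prod_univ_succ, mul_assoc]
    simp only [Fin.castSucc_zero, Fin.cons_zero, ← Fin.succ_castSucc, Fin.cons_succ, Fin.tail,
      ← Fin.succ_last]
    rw [Fin.cons_self_tail r]

theorem etaCycle_cons {k : ℕ} (μ ν : Idx) (r : Fin k → Idx × Idx) :
    etaCycle (Fin.cons (μ, ν) r : Fin (k + 1) → Idx × Idx) = etaChain r ν μ := by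
  unfold etaCycle
  rw [Fin.prod_univ_castSucc, ← prod_etaChain (μ, ν) r μ]
  simp [Fin.coeSucc_eq_succ]

theorem contr_etaChain {k : ℕ} (ν μ : Idx) :
    contr w (fun r : Fin k → Idx × Idx => etaChain r ν μ) = (eta * (w * eta) ^ k) ν μ := by
  induction k generalizing ν with
  | zero => simp [contr, etaChain]
  | succ k ih =>
    unfold contr at ih ⊢
    rw [← Equiv.sum_comp (Fin.consEquiv fun _ => Idx × Idx), Fintype.sum_prod_type]
    have h : ∀ (p : Idx × Idx) (r : Fin k → Idx × Idx),
        etaChain (Fin.consEquiv (fun _ => Idx × Idx) (p, r)) ν μ *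
          ∏ i, w (Fin.consEquiv (fun _ => Idx × Idx) (p, r) i).1
            (Fin.consEquiv (fun _ => Idx × Idx) (p, r) i).2 =
        eta ν p.1 * w p.1 p.2 * (etaChain r p.2 μ * ∏ i, w (r i).1 (r i).2) := fun p r => by
      rw [Fin.prod_univ_succ]
      change eta ν p.1 * etaChain r p.2 μ * (w p.1 p.2 * ∏ i, w (r i).1 (r i).2) = _
      ring
    simp only [h, ← Finset.mul_sum, ih]
    rw [Fintype.sum_prod_type, pow_succ', mul_assoc w, ← mul_assoc, Matrix.mul_apply,
      Finset.sum_comm]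
    refine Finset.sum_congr rfl fun j _ => ?_
    rw [Matrix.mul_apply, Finset.sum_mul]

theorem eta_isSymm : eta.IsSymm := Matrix.isSymm_diagonal _

theorem isSymm_eta_mul_pow (hw : w.IsSymm) (k : ℕ) : (eta * (w * eta) ^ k).IsSymm := by
  induction k with
  | zero => simpa using eta_isSymm
  | succ k ih =>
    have h : eta * (w * eta) ^ (k + 1) = eta * w * (eta * (w * eta) ^ k) := by
      rw [pow_succ']; simp only [mul_assoc]
    unfold Matrix.IsSymm at ih ⊢
    rw [h, Matrix.transpose_mul, ih, Matrix.transpose_mul, hw.eq, eta_isSymm.eq, ← h, pow_succ]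
    simp only [mul_assoc]

/-- With its first pair left open, `I` contracts to a matrix power: all `2^(k+1)` exchanges contribute
the same, those of the open pair because `η (wη)^k` is symmetric. -/
theorem contr_tensorI' (hw : w.IsSymm) (μ ν : Idx) (k : ℕ) :
    contr w (tensorI' μ ν (k := k)) = (eta * (w * eta) ^ k) μ ν := by
  have hs := isSymm_eta_mul_pow hw k
  have hb : ∀ b : Fin (k + 1) → Bool,
      contr w (fun r : Fin k → Idx × Idx => etaCycle fun i => if b i then
        ((Fin.cons (μ, ν) r : Fin (k + 1) → Idx × Idx) i).swap
          else (Fin.cons (μ, ν) r : Fin (k + 1) → Idx × Idx) i) = (eta * (w * eta) ^ k) μ ν := by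
    intro b
    have h : ∀ r : Fin k → Idx × Idx, (fun i => if b i then
        ((Fin.cons (μ, ν) r : Fin (k + 1) → Idx × Idx) i).swap
          else (Fin.cons (μ, ν) r : Fin (k + 1) → Idx × Idx) i) =
        Fin.cons (if b 0 then (ν, μ) else (μ, ν))
          fun i : Fin k => if b i.succ then (r i).swap else r i := fun r => by
      funext i
      refine Fin.cases ?_ (fun i => ?_) i <;> simp
    simp only [h]
    rw [contr_swap hw (fun i => b i.succ) fun r => etaCycle (Fin.cons _ r)]
    split
    · simp only [etaCycle_cons]; exact contr_etaChain _ _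
    · simp only [etaCycle_cons]; rw [contr_etaChain]; exact hs.apply _ _
  unfold tensorI' tensorI
  rw [contr_const_mul, contr_sum, Finset.sum_congr rfl fun b _ => hb b]
  simp

theorem contr_tensorI (hw : w.IsSymm) {k : ℕ} (hk : 1 ≤ k) :
    contr w (tensorI (N := k)) = ((w * eta) ^ k).trace := by
  obtain ⟨k, rfl⟩ := Nat.exists_eq_add_of_le' hk
  unfold contr
  rw [← Equiv.sum_comp (Fin.consEquiv fun _ => Idx × Idx), Fintype.sum_prod_type,
    Fintype.sum_prod_type, pow_succ', mul_assoc, Matrix.trace]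
  refine Finset.sum_congr rfl fun μ _ => ?_
  rw [Matrix.diag_apply, Matrix.mul_apply]
  refine Finset.sum_congr rfl fun ν _ => ?_
  rw [← (isSymm_eta_mul_pow hw k).apply ν μ, ← contr_tensorI' hw μ ν k, contr, Finset.mul_sum]
  refine Finset.sum_congr rfl fun r _ => ?_
  rw [Fin.prod_univ_succ]
  change tensorI' μ ν r * (w μ ν * ∏ i, w (r i).1 (r i).2) = _
  ring

/-- The coefficients `a_k = (-1)^{k+1} tr (wη)^k / (2k)` of `½ tr log (1 + wη)`. -/
noncomputable def halfLogTr (w : Matrix Idx Idx ℝ) (k : ℕ) : ℝ :=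
  (-1) ^ (k + 1) / (2 * (k : ℝ)) * ((w * eta) ^ k).trace

/-- The tensor `C` contracts to the `n`-th coefficient of `exp (½ tr log (1 + wη))`; the sign
`(-1)^(n+m)` and the factor `2^{-m}` of a composition with `m` blocks are distributed over them. -/
theorem contr_tensorC (hw : w.IsSymm) (n : ℕ) :
    contr w (tensorC (n := n)) = expCoeff (halfLogTr w) n := by
  unfold tensorC expCoeff
  rw [contr_pairSymm, contr_sum]
  refine Finset.sum_congr rfl fun c _ => ?_
  rw [contr_const_mul, contr_composition c fun i s => (1 / (c.blocksFun i : ℝ)) * tensorI s]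
  simp only [contr_const_mul]
  have h1 : ∀ i : Fin c.length, 1 / (c.blocksFun i : ℝ) * contr w (tensorI (N := c.blocksFun i)) =
      (-1) ^ (c.blocksFun i + 1) * 2 * halfLogTr w (c.blocksFun i) := fun i => by
    rw [contr_tensorI hw (c.one_le_blocksFun i), halfLogTr]
    have : ((-1 : ℝ) ^ (c.blocksFun i + 1)) * (-1) ^ (c.blocksFun i + 1) = 1 := by
      rw [← mul_pow]; simp
    have h0 : (c.blocksFun i : ℝ) ≠ 0 := by
      exact_mod_cast Nat.one_le_iff_ne_zero.mp (c.one_le_blocksFun i)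
    field_simp
    linear_combination -(((w * eta) ^ c.blocksFun i).trace) * this
  simp only [h1, Finset.prod_mul_distrib]
  rw [Finset.prod_pow_eq_pow_sum, Finset.sum_add_distrib, c.sum_blocksFun]
  simp only [Finset.sum_const, Finset.prod_const, Finset.card_univ, Fintype.card_fin, smul_eq_mul,
    mul_one]
  have : ((-1 : ℝ) ^ (n + c.length)) * (-1) ^ (n + c.length) = 1 := by
    rw [← mul_pow]; simp
  field_simp
  linear_combination (∏ i, halfLogTr w (c.blocksFun i)) * this

/-! ### The contracted `C` tensors as Cauchy products -/

theorem contr_tensorCI (hw : w.IsSymm) (μ ν : Idx) (n : ℕ) :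
    contr w (tensorCI μ ν (n := n)) = ∑ k ∈ Finset.Nat.antidiagonalTuple 2 n,
      expCoeff (halfLogTr w) (k 0) * ((-1) ^ (k 1) * (eta * (w * eta) ^ (k 1)) μ ν) := by
  unfold tensorCI
  rw [contr_pairSymm, contr_sum]
  refine Finset.sum_congr rfl fun k hk => ?_
  rw [Finset.Nat.mem_antidiagonalTuple, Fin.sum_univ_two] at hk
  simp only [mul_assoc]
  rw [contr_const_mul, contr_slice_mul hk tensorC (tensorI' μ ν), contr_tensorC hw,
    contr_tensorI' hw, show n - k 0 = k 1 by omega]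
  ring

theorem contr_tensorCII (hw : w.IsSymm) (μ ν α β : Idx) (n : ℕ) :
    contr w (tensorCII μ ν α β (n := n)) = ∑ k ∈ Finset.Nat.antidiagonalTuple 3 n,
      expCoeff (halfLogTr w) (k 0) * ((-1) ^ (k 1) * (eta * (w * eta) ^ (k 1)) μ ν) *
        ((-1) ^ (k 2) * (eta * (w * eta) ^ (k 2)) α β) := by
  unfold tensorCII
  rw [contr_pairSymm, contr_sum]
  refine Finset.sum_congr rfl fun k hk => ?_
  rw [Finset.Nat.mem_antidiagonalTuple, Fin.sum_univ_three] at hk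
  have hs : ∀ r : Fin n → Idx × Idx, (-1 : ℝ) ^ (n - k 0) * tensorC (slice r 0 (k 0)) *
      tensorI' μ ν (slice r (k 0) (k 1)) * tensorI' α β (slice r (k 0 + k 1) (k 2)) =
      (-1 : ℝ) ^ (n - k 0) * (tensorC (slice r 0 (k 0)) *
        (fun s : Fin (k 1 + k 2) → Idx × Idx => tensorI' μ ν (slice s 0 (k 1)) *
          tensorI' α β (slice s (k 1) (k 2))) (slice r (k 0) (k 1 + k 2))) := fun r => by
    beta_reduce
    rw [slice_slice r (by omega), slice_slice r (by omega), add_zero]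
    ring
  simp only [hs]
  rw [contr_const_mul, contr_slice_mul (by omega) tensorC
      (fun s : Fin (k 1 + k 2) → Idx × Idx => tensorI' μ ν (slice s 0 (k 1)) *
          tensorI' α β (slice s (k 1) (k 2))),
    contr_slice_mul rfl (tensorI' μ ν) (tensorI' α β), contr_tensorC hw,
    contr_tensorI' hw, contr_tensorI' hw, show n - k 0 = k 1 + k 2 by omega, pow_add]
  ring

theorem contr_tensorCIII (hw : w.IsSymm) (μ ν α β l τ : Idx) (n : ℕ) :
    contr w (tensorCIII μ ν α β l τ (n := n)) = ∑ k ∈ Finset.Nat.antidiagonalTuple 4 n,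
      expCoeff (halfLogTr w) (k 0) * ((-1) ^ (k 1) * (eta * (w * eta) ^ (k 1)) μ ν) *
        ((-1) ^ (k 2) * (eta * (w * eta) ^ (k 2)) α β) *
        ((-1) ^ (k 3) * (eta * (w * eta) ^ (k 3)) l τ) := by
  unfold tensorCIII
  rw [contr_pairSymm, contr_sum]
  refine Finset.sum_congr rfl fun k hk => ?_
  rw [Finset.Nat.mem_antidiagonalTuple, Fin.sum_univ_four] at hk
  have hs : ∀ r : Fin n → Idx × Idx, (-1 : ℝ) ^ (n - k 0) * tensorC (slice r 0 (k 0)) *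
      tensorI' μ ν (slice r (k 0) (k 1)) * tensorI' α β (slice r (k 0 + k 1) (k 2)) *
        tensorI' l τ (slice r (k 0 + k 1 + k 2) (k 3)) =
      (-1 : ℝ) ^ (n - k 0) * (tensorC (slice r 0 (k 0)) *
        (fun s : Fin (k 1 + (k 2 + k 3)) → Idx × Idx => tensorI' μ ν (slice s 0 (k 1)) *
          (fun t : Fin (k 2 + k 3) → Idx × Idx => tensorI' α β (slice t 0 (k 2)) *
            tensorI' l τ (slice t (k 2) (k 3))) (slice s (k 1) (k 2 + k 3)))
          (slice r (k 0) (k 1 + (k 2 + k 3)))) := fun r => by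
    beta_reduce
    rw [slice_slice (n := k 1 + (k 2 + k 3)) _ (by omega),
      slice_slice (n := k 1 + (k 2 + k 3)) _ (by omega),
      slice_slice r (by omega), slice_slice r (by omega),
      slice_slice r (by omega)]
    simp only [add_zero, ← add_assoc]
    ring
  simp only [hs]
  rw [contr_const_mul, contr_slice_mul (by omega) tensorC
      (fun s : Fin (k 1 + (k 2 + k 3)) → Idx × Idx => tensorI' μ ν (slice s 0 (k 1)) *
          (fun t : Fin (k 2 + k 3) → Idx × Idx => tensorI' α β (slice t 0 (k 2)) *
            tensorI' l τ (slice t (k 2) (k 3))) (slice s (k 1) (k 2 + k 3))),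
    contr_slice_mul rfl (tensorI' μ ν) (fun t : Fin (k 2 + k 3) → Idx × Idx =>
      tensorI' α β (slice t 0 (k 2)) * tensorI' l τ (slice t (k 2) (k 3))),
    contr_slice_mul rfl (tensorI' α β) (tensorI' l τ),
    contr_tensorC hw, contr_tensorI' hw, contr_tensorI' hw, contr_tensorI' hw,
    show n - k 0 = k 1 + k 2 + k 3 by omega, pow_add, pow_add]
  ring

theorem eta_mul_eta : eta * eta = 1 := by
  rw [eta, Matrix.diagonal_mul_diagonal, ← Matrix.diagonal_one]
  congr 1
  funext i
  fin_cases i <;> simp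

theorem contr_tensorCE (hw : w.IsSymm) (μ ν : Idx) (n : ℕ) :
    contr w (tensorCE μ ν (n := n)) = ∑ k ∈ Finset.Nat.antidiagonalTuple 2 n,
      expCoeff (halfLogTr w) (k 0) *
        (Ring.choose (-(1 / 2) : ℝ) (k 1) * ((w * eta) ^ (k 1)) μ ν) := by
  unfold tensorCE
  rw [contr_pairSymm, contr_sum]
  refine Finset.sum_congr rfl fun k hk => ?_
  rw [Finset.Nat.mem_antidiagonalTuple, Fin.sum_univ_two] at hk
  simp only [mul_assoc]
  rw [contr_const_mul, contr_slice_mul hk tensorC fun s => ∑ l, eta μ l * tensorI' l ν s,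
    contr_tensorC hw, contr_sum]
  simp only [contr_const_mul, contr_tensorI' hw]
  rw [← Matrix.mul_apply, ← Matrix.mul_assoc, eta_mul_eta, Matrix.one_mul]
  ring

end Contraction

section MatrixSeries

-- The operator norm for the sup norm on vectors: the maximal absolute row sum.
open scoped Matrix.Norms.Operator

theorem hasSum_entry {ι n : Type*} {f : ι → Matrix n n ℝ} {A : Matrix n n ℝ} (h : HasSum f A)
    (i j : n) : HasSum (fun k => f k i j) (A i j) :=
  h.map (Matrix.entryAddMonoidHom ℝ i j) (continuous_id.matrix_elem i j)

theorem hasSum_trace {ι n : Type*} [Fintype n] {f : ι → Matrix n n ℝ} {A : Matrix n n ℝ}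
    (h : HasSum f A) : HasSum (fun k => (f k).trace) A.trace :=
  h.map (Matrix.traceAddMonoidHom n ℝ) continuous_id.matrix_trace

theorem map_ofReal_mul {n : Type*} [Fintype n] (A B : Matrix n n ℝ) :
    (A * B).map Complex.ofReal = A.map Complex.ofReal * B.map Complex.ofReal :=
  Matrix.map_mul (f := Complex.ofRealHom)

theorem Commute.map_ofReal {n : Type*} [Fintype n] {A B : Matrix n n ℝ} (h : Commute A B) :
    Commute (A.map Complex.ofReal) (B.map Complex.ofReal) := by
  rw [Commute, SemiconjBy, ← map_ofReal_mul, ← map_ofReal_mul, h.eq]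

variable {n : Type*} [Fintype n] [DecidableEq n]

/-! ### Power series in a matrix -/

theorem abs_entry_le_norm (A : Matrix n n ℝ) (i j : n) : |A i j| ≤ ‖A‖ := by
  have h := Matrix.linfty_opNorm_def A
  have h1 : ∑ j, ‖A i j‖₊ ≤ Finset.univ.sup fun i => ∑ j, ‖A i j‖₊ :=
    Finset.le_sup (f := fun i => ∑ j, ‖A i j‖₊) (Finset.mem_univ i)
  have h2 : ‖A i j‖₊ ≤ ∑ j, ‖A i j‖₊ :=
    Finset.single_le_sum (f := fun j => ‖A i j‖₊) (fun _ _ => zero_le) (Finset.mem_univ j)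
  rw [h]
  exact_mod_cast h2.trans h1

theorem norm_le_of_forall_sum_le (A : Matrix n n ℝ) {θ : ℝ} (hθ : 0 ≤ θ)
    (h : ∀ i, ∑ j, |A i j| ≤ θ) : ‖A‖ ≤ θ := by
  rw [Matrix.linfty_opNorm_def]
  lift θ to NNReal using hθ
  refine NNReal.coe_le_coe.2 (Finset.sup_le fun i _ => ?_)
  rw [← NNReal.coe_le_coe]
  simpa using h i

theorem abs_trace_le_norm (A : Matrix n n ℝ) : |A.trace| ≤ Fintype.card n * ‖A‖ := by
  refine (Finset.abs_sum_le_sum_abs _ _).trans ?_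
  refine (Finset.sum_le_sum fun i _ => abs_entry_le_norm A i i).trans ?_
  simp

theorem hasSum_neg_pow {X : Matrix n n ℝ} (hX : ‖X‖ < 1) :
    HasSum (fun k : ℕ => (-1 : ℝ) ^ k • X ^ k) (1 + X)⁻¹ := by
  have h1 : ‖-X‖ < 1 := by rwa [norm_neg]
  have h2 := (summable_geometric_of_norm_lt_one h1).hasSum
  have h3 : (1 + X)⁻¹ = ∑' k : ℕ, (-X) ^ k := by
    refine Matrix.inv_eq_right_inv ?_
    have h := mul_neg_geom_series (-X) h1
    rw [sub_neg_eq_add] at h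
    exact h
  rw [h3]
  refine h2.congr_fun fun k => ?_
  rw [← neg_one_smul ℝ X, smul_pow]

theorem isUnit_det_one_add {X : Matrix n n ℝ} (hX : ‖X‖ < 1) : IsUnit (1 + X).det := by
  have h1 : ‖-X‖ < 1 := by rwa [norm_neg]
  have h := mul_neg_geom_series (-X) h1
  rw [sub_neg_eq_add] at h
  exact (Matrix.isUnit_iff_isUnit_det _).1 (IsUnit.of_mul_eq_one _ h)

/-! ### The determinant as the exponential of a trace -/

theorem hasDerivAt_det_one_add_smul (N : Matrix n n ℝ) :
    HasDerivAt (fun s : ℝ => (1 + s • N).det) N.trace 0 := by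
  have h := (1 + (Polynomial.X : Polynomial ℝ) • N.map Polynomial.C).det.hasDerivAt 0
  rw [Matrix.derivative_det_one_add_X_smul] at h
  refine h.congr_of_eventuallyEq (Filter.Eventually.of_forall fun s => ?_)
  change _ = Polynomial.evalRingHom s _
  rw [RingHom.map_det]
  refine congrArg Matrix.det ?_
  ext i j
  by_cases hij : i = j <;> simp [hij] <;> ring

/-- Jacobi's formula on the line `1 + s X`, obtained at `t` from the one at the identity by factoring
out `1 + t X`. -/
theorem hasDerivAt_det_one_add_smul_of_isUnit (X : Matrix n n ℝ) {t : ℝ}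
    (ht : IsUnit (1 + t • X).det) :
    HasDerivAt (fun s : ℝ => (1 + s • X).det)
      ((1 + t • X).det * ((1 + t • X)⁻¹ * X).trace) t := by
  have h := (hasDerivAt_det_one_add_smul ((1 + t • X)⁻¹ * X)).const_mul (1 + t • X).det
  have h2 : HasDerivAt (fun s : ℝ => s - t) 1 t := (hasDerivAt_id t).sub_const t
  have h3 := HasDerivAt.comp_of_eq t h h2 (sub_self t).symm
  rw [mul_one] at h3
  refine h3.congr_of_eventuallyEq (Filter.Eventually.of_forall fun s => ?_)
  simp only [Function.comp_apply]
  rw [← Matrix.det_mul]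
  congr 1
  rw [Matrix.mul_add, Matrix.mul_one, Matrix.mul_smul, ← Matrix.mul_assoc,
    Matrix.mul_nonsing_inv _ ht, Matrix.one_mul]
  module

theorem abs_trace_pow_le {X : Matrix n n ℝ} {θ : ℝ} (hX : ‖X‖ ≤ θ) (k : ℕ) :
    |(X ^ (k + 1)).trace| ≤ Fintype.card n * θ ^ (k + 1) := by
  refine (abs_trace_le_norm _).trans ?_
  gcongr
  exact (norm_pow_le' X k.succ_pos).trans (pow_le_pow_left₀ (norm_nonneg _) hX _)

/-- `det (1 + X) = exp (tr log (1 + X))`: both sides of `det (1 + t X) = exp (tr log (1 + t X))`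
have the logarithmic derivative `tr ((1 + t X)⁻¹ X)`. -/
theorem exp_tsum_trace_pow {X : Matrix n n ℝ} (hX : ‖X‖ < 1) :
    Real.exp (∑' k : ℕ, (-1) ^ k / ((k : ℝ) + 1) * (X ^ (k + 1)).trace) = (1 + X).det := by
  -- A ball of radius `2 / (1 + ‖X‖) > 1` contains both `0` and `1`, and `‖t X‖ ≤ q < 1` on it.
  set q := 2 / (1 + ‖X‖) * ‖X‖ with hq
  have h0 : 0 ≤ ‖X‖ := norm_nonneg X
  have hR : 1 < 2 / (1 + ‖X‖) := by rw [lt_div_iff₀ (by positivity)]; linarith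
  have hq0 : 0 ≤ q := by positivity
  have hq1 : q < 1 := by
    rw [hq, div_mul_eq_mul_div, div_lt_one (by positivity)]; linarith
  set B := Metric.ball (0 : ℝ) (2 / (1 + ‖X‖)) with hB
  have hball : ∀ t ∈ B, |t| * ‖X‖ ≤ q := fun t ht => by
    rw [hB, mem_ball_zero_iff, Real.norm_eq_abs] at ht
    exact mul_le_mul_of_nonneg_right ht.le h0
  have hnorm : ∀ t ∈ B, ‖t • X‖ < 1 := fun t ht => by
    rw [norm_smul]; exact (hball t ht).trans_lt hq1
  have hpre : IsPreconnected B := (convex_ball _ _).isPreconnected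
  let g : ℕ → ℝ → ℝ := fun k t => (-1) ^ k / ((k : ℝ) + 1) * (X ^ (k + 1)).trace * t ^ (k + 1)
  let g' : ℕ → ℝ → ℝ := fun k t => (-1) ^ k * (X ^ (k + 1)).trace * t ^ k
  have hg : ∀ k, ∀ t ∈ B, HasDerivAt (g k) (g' k t) t := fun k t _ => by
    refine ((hasDerivAt_pow (k + 1) t).const_mul
      ((-1) ^ k / ((k : ℝ) + 1) * (X ^ (k + 1)).trace)).congr_deriv ?_
    simp only [g', Nat.cast_add, Nat.cast_one, add_tsub_cancel_right]
    field_simp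
  have hg' : ∀ k, ∀ t ∈ B, ‖g' k t‖ ≤ Fintype.card n * ‖X‖ * q ^ k := fun k t ht => by
    simp only [g', norm_mul, norm_pow, norm_neg, norm_one, one_pow, one_mul, Real.norm_eq_abs]
    calc |(X ^ (k + 1)).trace| * |t| ^ k
        ≤ Fintype.card n * ‖X‖ ^ (k + 1) * |t| ^ k := by
          gcongr; exact abs_trace_pow_le le_rfl k
      _ = Fintype.card n * ‖X‖ * (|t| * ‖X‖) ^ k := by ring
      _ ≤ _ := by
          gcongr
          exact hball t ht
  have hu : Summable fun k : ℕ => (Fintype.card n : ℝ) * ‖X‖ * q ^ k :=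
    (summable_geometric_of_lt_one hq0 hq1).mul_left _
  have hzero : (0 : ℝ) ∈ B := by rw [hB, mem_ball_zero_iff, norm_zero]; positivity
  have hone : (1 : ℝ) ∈ B := by rw [hB, mem_ball_zero_iff, norm_one]; exact hR
  have hg0 : ∀ k, g k 0 = 0 := fun k => by simp [g]
  have hder : ∀ t ∈ B, HasDerivAt (fun t => ∑' k, g k t) (((1 + t • X)⁻¹ * X).trace) t := by
    intro t ht
    have h1 := hasDerivAt_tsum_of_isPreconnected hu Metric.isOpen_ball hpre hg hg' hzero
      (by simpa only [hg0] using summable_zero) ht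
    have h2 : HasSum (fun k => g' k t) (((1 + t • X)⁻¹ * X).trace) := by
      refine (hasSum_trace ((hasSum_neg_pow (hnorm t ht)).mul_right X)).congr_fun fun k => ?_
      rw [smul_pow, smul_smul, Matrix.smul_mul, Matrix.trace_smul, ← pow_succ, smul_eq_mul]
      simp only [g']
      ring
    rwa [h2.tsum_eq] at h1
  -- Hence `det (1 + t X) * exp (-∑ g k t)` is constant on the ball, equal to its value at `0`.
  have hE : ∀ t ∈ B, HasDerivAt (fun t => (1 + t • X).det * Real.exp (-∑' k, g k t)) 0 t := by
    intro t ht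
    refine ((hasDerivAt_det_one_add_smul_of_isUnit X (isUnit_det_one_add (hnorm t ht))).mul
      (hder t ht).neg.exp).congr_deriv ?_
    ring
  have hconst := Metric.isOpen_ball.is_const_of_deriv_eq_zero hpre
    (fun t ht => (hE t ht).differentiableAt.differentiableWithinAt)
    (fun t ht => (hE t ht).deriv) hone hzero
  simp only [hg0, tsum_zero, neg_zero, Real.exp_zero, mul_one, zero_smul, add_zero, one_smul,
    Matrix.det_one] at hconst
  simp only [g, one_pow, mul_one, Real.exp_neg] at hconst
  exact (eq_of_mul_inv_eq_one hconst).symm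

/-! ### The principal square root of `(1 + X)⁻¹` -/

theorem succ_mul_choose_succ (r : ℝ) (k : ℕ) :
    ((k : ℝ) + 1) * Ring.choose r (k + 1) = Ring.choose r k * (r - k) := by
  have h1 := Ring.descPochhammer_eq_factorial_smul_choose r (k + 1)
  have h2 := Ring.descPochhammer_eq_factorial_smul_choose r k
  rw [descPochhammer_succ_right, Polynomial.smeval_mul, h2] at h1
  have h3 : (Polynomial.X - (k : Polynomial ℤ)).smeval r = r - k := by
    rw [Polynomial.smeval_sub, Polynomial.smeval_X, pow_one, Polynomial.smeval_natCast]
    simp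
  rw [h3, Nat.factorial_succ, nsmul_eq_mul, nsmul_eq_mul] at h1
  have h4 : (k.factorial : ℝ) ≠ 0 := by positivity
  push_cast at h1
  apply mul_left_cancel₀ h4
  linear_combination -h1

theorem abs_choose_neg_half_le_one (k : ℕ) : |Ring.choose (-(1 / 2) : ℝ) k| ≤ 1 := by
  induction k with
  | zero => simp
  | succ k ih =>
    have h := congrArg abs (succ_mul_choose_succ (-(1 / 2)) k)
    rw [abs_mul, abs_mul, abs_of_pos (by positivity : (0 : ℝ) < k + 1)] at h
    have h2 : |(-(1 / 2) : ℝ) - k| ≤ k + 1 := by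
      rw [abs_le]; constructor <;> linarith [(Nat.cast_nonneg k : (0 : ℝ) ≤ k)]
    have h3 : |Ring.choose (-(1 / 2) : ℝ) k| * |(-(1 / 2) : ℝ) - k| ≤ 1 * (k + 1) :=
      mul_le_mul ih h2 (abs_nonneg _) zero_le_one
    rw [← h, one_mul] at h3
    exact le_of_mul_le_mul_left (by linarith) (by positivity : (0 : ℝ) < k + 1)

theorem choose_neg_one (k : ℕ) : Ring.choose (-1 : ℝ) k = (-1) ^ k := by
  induction k with
  | zero => simp
  | succ k ih =>
    have h := succ_mul_choose_succ (-1) k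
    rw [ih] at h
    apply mul_left_cancel₀ (by positivity : (k : ℝ) + 1 ≠ 0)
    rw [h]; ring

/-- The binomial series of `(1 + X)^{-1/2}`. -/
noncomputable def invSqrtOneAdd (X : Matrix n n ℝ) : Matrix n n ℝ :=
  ∑' k : ℕ, Ring.choose (-(1 / 2) : ℝ) k • X ^ k

theorem summable_norm_invSqrtOneAdd {X : Matrix n n ℝ} (hX : ‖X‖ < 1) :
    Summable fun k : ℕ => ‖Ring.choose (-(1 / 2) : ℝ) k • X ^ k‖ := by
  refine (summable_nat_add_iff 1).1 (Summable.of_nonneg_of_le (fun _ => norm_nonneg _) (fun k => ?_)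
    ((summable_geometric_of_lt_one (norm_nonneg X) hX).comp_injective (add_left_injective 1)))
  rw [norm_smul]
  calc _ ≤ 1 * ‖X‖ ^ (k + 1) := mul_le_mul (abs_choose_neg_half_le_one _)
        (norm_pow_le' X k.succ_pos) (norm_nonneg _) zero_le_one
    _ = _ := one_mul _

theorem hasSum_invSqrtOneAdd {X : Matrix n n ℝ} (hX : ‖X‖ < 1) :
    HasSum (fun k : ℕ => Ring.choose (-(1 / 2) : ℝ) k • X ^ k) (invSqrtOneAdd X) :=
  (summable_norm_invSqrtOneAdd hX).of_norm.hasSum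

/-- The square of the binomial series is the geometric series, by Vandermonde's identity for
`-1/2 - 1/2 = -1`. -/
theorem invSqrtOneAdd_mul_self {X : Matrix n n ℝ} (hX : ‖X‖ < 1) :
    invSqrtOneAdd X * invSqrtOneAdd X = (1 + X)⁻¹ := by
  have hs := summable_norm_invSqrtOneAdd hX
  have h1 := tsum_mul_tsum_eq_tsum_sum_antidiagonal_of_summable_norm hs hs
  have h2 : ∀ m, ∑ kl ∈ Finset.HasAntidiagonal.antidiagonal m,
      (Ring.choose (-(1 / 2) : ℝ) kl.1 • X ^ kl.1) *
      (Ring.choose (-(1 / 2) : ℝ) kl.2 • X ^ kl.2) = (-1 : ℝ) ^ m • X ^ m := fun m => by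
    rw [← choose_neg_one, show (-1 : ℝ) = -(1 / 2) + -(1 / 2) by norm_num,
      Ring.add_choose_eq m (Commute.all _ _), Finset.sum_smul]
    refine Finset.sum_congr rfl fun kl hkl => ?_
    rw [Finset.HasAntidiagonal.mem_antidiagonal] at hkl
    rw [smul_mul_smul_comm, ← pow_add, hkl]
  simp only [h2] at h1
  rw [← (hasSum_neg_pow hX).tsum_eq]
  exact h1

theorem Commute.invSqrtOneAdd_right {S X : Matrix n n ℝ} (hX : ‖X‖ < 1) (h : Commute S X) :
    Commute S (invSqrtOneAdd X) := by
  have h1 := (hasSum_invSqrtOneAdd hX).mul_left S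
  have h2 := (hasSum_invSqrtOneAdd hX).mul_right S
  refine h1.unique (h2.congr_fun fun k => ?_)
  rw [Matrix.mul_smul, Matrix.smul_mul, (h.pow_right k).eq]

/-- Two commuting complex matrices have a common eigenvector in every eigenspace of the first. -/
theorem exists_common_eigenvector {A B : Matrix n n ℂ} (h : Commute A B) {z : ℂ} {v : n → ℂ}
    (hv : v ≠ 0) (hAv : A.mulVec v = z • v) :
    ∃ u ≠ 0, A.mulVec u = z • u ∧ ∃ y : ℂ, B.mulVec u = y • u := by
  let E := Module.End.eigenspace (Matrix.toLin' A) z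
  have hmem : ∀ u, u ∈ E ↔ A.mulVec u = z • u := fun u => by
    rw [Module.End.mem_eigenspace_iff, Matrix.toLin'_apply]
  have hmaps : ∀ u ∈ E, Matrix.toLin' B u ∈ E := fun u hu => by
    rw [hmem] at hu ⊢
    rw [Matrix.toLin'_apply, Matrix.mulVec_mulVec, h.eq, ← Matrix.mulVec_mulVec, hu,
      Matrix.mulVec_smul]
  have : Nontrivial E := ⟨⟨⟨v, (hmem v).2 hAv⟩, 0, fun h0 => hv (congrArg Subtype.val h0)⟩⟩
  obtain ⟨y, hy⟩ := Module.End.exists_eigenvalue ((Matrix.toLin' B).restrict hmaps)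
  obtain ⟨u, hu⟩ := hy.exists_hasEigenvector
  refine ⟨u, fun h0 => hu.2 (Subtype.ext h0), (hmem u).1 u.2, y, ?_⟩
  have := congrArg Subtype.val hu.apply_eq_smul
  simpa using this

theorem mem_spectrum_iff_exists_mulVec {A : Matrix n n ℂ} {z : ℂ} :
    z ∈ spectrum ℂ A ↔ ∃ v ≠ 0, A.mulVec v = z • v := by
  rw [← Matrix.spectrum_toLin', ← Module.End.hasEigenvalue_iff_mem_spectrum]
  constructor
  · intro h
    obtain ⟨v, hv⟩ := h.exists_hasEigenvector
    exact ⟨v, hv.2, by simpa using hv.apply_eq_smul⟩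
  · rintro ⟨v, hv, h⟩
    exact Module.End.hasEigenvalue_of_hasEigenvector
      (Module.End.hasEigenvector_iff.2 ⟨Module.End.mem_eigenspace_iff.2 (by simpa using h), hv⟩)

theorem re_one_add_cpow_neg_half_pos {z : ℂ} (hz : ‖z‖ < 1) :
    0 < ((1 + z) ^ (-(1 / 2) : ℂ)).re := by
  have h1 : 0 < (1 + z).re := by
    have h2 := abs_lt.1 ((Complex.abs_re_le_norm z).trans_lt hz)
    simp only [Complex.add_re, Complex.one_re]
    linarith [h2.1]
  have h0 : 1 + z ≠ 0 := fun h => by rw [h] at h1; simp at h1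
  have h2 := abs_lt.1 (Complex.abs_arg_lt_pi_div_two_iff.2 (Or.inl h1))
  rw [Complex.cpow_def_of_ne_zero h0, Complex.exp_re]
  refine mul_pos (Real.exp_pos _) (Real.cos_pos_of_mem_Ioo ?_)
  have h3 : (Complex.log (1 + z) * (-(1 / 2) : ℂ)).im = -(Complex.arg (1 + z) / 2) := by
    rw [show (-(1 / 2) : ℂ) = ((-(1 / 2) : ℝ) : ℂ) by push_cast; ring, Complex.im_mul_ofReal,
      Complex.log_im]
    ring
  rw [h3]
  constructor <;> linarith [Real.pi_pos]

/-- An eigenvalue of the binomial series has an eigenvector in common with `X`, and is thus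
`(1 + y)^{-1/2}` for an eigenvalue `y` of `X`, where `|y| < 1`. -/
theorem re_spectrum_invSqrtOneAdd_pos {X : Matrix n n ℝ} (hX : ‖X‖ < 1) {z : ℂ}
    (hz : z ∈ spectrum ℂ ((invSqrtOneAdd X).map Complex.ofReal)) : 0 < z.re := by
  obtain ⟨v, hv, hTv⟩ := mem_spectrum_iff_exists_mulVec.1 hz
  have hc := Commute.map_ofReal (Commute.invSqrtOneAdd_right hX (Commute.refl X)).symm
  obtain ⟨u, hu, hTu, y, hy⟩ := exists_common_eigenvector hc hv hTv
  have hXc : ‖X.map Complex.ofReal‖ = ‖X‖ := by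
    simp [Matrix.linfty_opNorm_def]
  have hy1 : ‖y‖ < 1 := by
    have h := Matrix.linfty_opNorm_mulVec (X.map Complex.ofReal) u
    rw [hy, norm_smul, hXc] at h
    exact (le_of_mul_le_mul_right h (norm_pos_iff.2 hu)).trans_lt hX
  have hpow : ∀ k : ℕ, (X ^ k).map Complex.ofReal = (X.map Complex.ofReal) ^ k := fun k => by
    exact Matrix.map_pow (f := Complex.ofRealHom) X k
  have hpu : ∀ k : ℕ, ((X ^ k).map Complex.ofReal).mulVec u = y ^ k • u := fun k => by
    rw [hpow]
    induction k with
    | zero => simp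
    | succ k ih => rw [pow_succ, ← Matrix.mulVec_mulVec, hy, Matrix.mulVec_smul, ih, smul_smul,
        ← pow_succ']
  have hsum := (Complex.one_add_cpow_hasFPowerSeriesOnBall_zero (a := -(1 / 2))).hasSum
    (y := y) (by
      rw [Metric.mem_eball, edist_zero_right, ← ofReal_norm]
      exact ENNReal.ofReal_lt_one.2 hy1)
  obtain ⟨i, hi⟩ := Function.ne_iff.1 hu
  have hT : HasSum (fun k : ℕ => Complex.ofReal (Ring.choose (-(1 / 2) : ℝ) k) * (y ^ k * u i))
      (z * u i) := by
    have h1 : HasSum (fun k : ℕ => ∑ j, Complex.ofReal ((Ring.choose (-(1 / 2) : ℝ) k • X ^ k) i j)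
        * u j) (∑ j, Complex.ofReal (invSqrtOneAdd X i j) * u j) :=
      hasSum_sum fun j _ => (Complex.hasSum_ofReal.2
        (hasSum_entry (hasSum_invSqrtOneAdd hX) i j)).mul_right _
    have h2 : ∑ j, Complex.ofReal (invSqrtOneAdd X i j) * u j = z * u i := congrFun hTu i
    rw [h2] at h1
    refine h1.congr_fun fun k => ?_
    have h3 : ∑ j, Complex.ofReal ((X ^ k) i j) * u j = y ^ k * u i := congrFun (hpu k) i
    rw [← h3, Finset.mul_sum]
    refine Finset.sum_congr rfl fun j _ => ?_
    simp [mul_assoc]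
  have hz : z = (1 + y) ^ (-(1 / 2) : ℂ) := by
    refine mul_right_cancel₀ (hi : u i ≠ 0) (hT.unique ?_)
    rw [zero_add] at hsum
    refine (hsum.mul_right (u i)).congr_fun fun k => ?_
    rw [binomialSeries_apply]
    simp [Complex.ofReal_choose, mul_assoc]
  rw [hz]
  exact re_one_add_cpow_neg_half_pos hy1

/-- The square root of `(1 + X)⁻¹` whose spectrum lies in the right half plane is unique. -/
theorem eq_invSqrtOneAdd {X S : Matrix n n ℝ} (hX : ‖X‖ < 1) (hS : S * S = (1 + X)⁻¹)
    (hpos : ∀ z ∈ spectrum ℂ (S.map Complex.ofReal), 0 < z.re) : S = invSqrtOneAdd X := by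
  set T := invSqrtOneAdd X with hT
  have hSX : Commute S X := by
    have h1 : Commute S (1 + X)⁻¹ := by rw [← hS]; exact (Commute.refl S).mul_right (Commute.refl S)
    have h2 : Commute S (1 + X) := by
      have h3 : (1 + X) * (1 + X)⁻¹ = 1 := Matrix.mul_nonsing_inv _ (isUnit_det_one_add hX)
      have h4 : (1 + X)⁻¹ * (1 + X) = 1 := Matrix.nonsing_inv_mul _ (isUnit_det_one_add hX)
      calc S * (1 + X) = (1 + X) * ((1 + X)⁻¹ * S) * (1 + X) := by
            rw [← Matrix.mul_assoc, h3, Matrix.one_mul]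
        _ = (1 + X) * S := by
            rw [← h1.eq, Matrix.mul_assoc, Matrix.mul_assoc, h4, Matrix.mul_one]
    simpa using h2.sub_right (Commute.one_right S)
  have hST : Commute S T := Commute.invSqrtOneAdd_right hX hSX
  -- `S + T` is invertible: on a common eigenvector in its kernel, `S` and `T` would have opposite
  -- eigenvalues, but both have positive real part.
  have hprod : (S - T) * (S + T) = 0 := by
    rw [Matrix.sub_mul, Matrix.mul_add, Matrix.mul_add, hS, hST.eq, hT, invSqrtOneAdd_mul_self hX]
    abel
  have hdet : IsUnit (S + T).det := by
    rw [isUnit_iff_ne_zero]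
    intro h0
    have h1 : (S.map Complex.ofReal + T.map Complex.ofReal).det = 0 := by
      have h2 : S.map Complex.ofReal + T.map Complex.ofReal = Complex.ofRealHom.mapMatrix (S + T) := by
        ext i j; simp
      rw [h2, ← RingHom.map_det, h0, map_zero]
    obtain ⟨v, hv, hv0⟩ := Matrix.exists_mulVec_eq_zero_iff.2 h1
    have hc : Commute (S.map Complex.ofReal + T.map Complex.ofReal) (S.map Complex.ofReal) :=
      (Commute.refl _).add_left (Commute.map_ofReal hST.symm)
    obtain ⟨u, hu, hu0, y, hy⟩ := exists_common_eigenvector hc (z := 0) hv (by rw [hv0, zero_smul])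
    have hTu : (T.map Complex.ofReal).mulVec u = (-y) • u := by
      rw [Matrix.add_mulVec, hy, zero_smul] at hu0
      rw [neg_smul]; exact eq_neg_of_add_eq_zero_right hu0
    have p1 := hpos y (mem_spectrum_iff_exists_mulVec.2 ⟨u, hu, hy⟩)
    have p2 := re_spectrum_invSqrtOneAdd_pos hX (mem_spectrum_iff_exists_mulVec.2 ⟨u, hu, hTu⟩)
    rw [Complex.neg_re] at p2
    linarith
  have h5 := congrArg (· * (S + T)⁻¹) hprod
  simp only [Matrix.mul_assoc, Matrix.mul_nonsing_inv _ hdet, Matrix.mul_one, Matrix.zero_mul] at h5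
  exact sub_eq_zero.1 h5

end MatrixSeries

open MeasureTheory
open scoped FourierTransform LineDeriv

section Momentum

/-! ### The momentum representation of Schwartz functions -/

/-- Lowering the index of a momentum, as a linear isometry of the Euclidean space `V`. -/
noncomputable def lowerIso : V ≃ₗᵢ[ℝ] V :=
  LinearIsometryEquiv.piLpCongrRight 2 fun i : Fin 4 =>
    if i = 0 then LinearIsometryEquiv.refl ℝ ℝ else LinearIsometryEquiv.neg ℝ

theorem sum_eta_mul {R : Type*} [Semiring R] [Algebra ℝ R] (μ : Idx) (f : Idx → R) :
    ∑ l, algebraMap ℝ R (eta μ l) * f l = algebraMap ℝ R (eta μ μ) * f μ := by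
  refine Finset.sum_eq_single μ (fun l _ hl => ?_) (by simp)
  rw [eta, Matrix.diagonal_apply_ne _ hl.symm, map_zero, zero_mul]

theorem lowerIdx_eq (p : V) (μ : Idx) : lowerIdx p μ = eta μ μ * p μ :=
  sum_eta_mul μ fun l => p l

theorem lowerIso_apply (p : V) (μ : Idx) : lowerIso p μ = lowerIdx p μ := by
  rw [lowerIdx_eq]
  fin_cases μ <;> simp [lowerIso, eta]

theorem lorentz_eq_inner (p x : V) : lorentz p x = inner ℝ (lowerIso p) x := by
  rw [lorentz, Finset.sum_comm, PiLp.inner_apply]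
  refine Finset.sum_congr rfl fun ν _ => ?_
  rw [lowerIso_apply, lowerIdx, ← Finset.sum_mul]
  have : ∑ μ, eta μ ν * p μ = ∑ μ, eta ν μ * p μ :=
    Finset.sum_congr rfl fun μ _ => by rw [eta_isSymm.apply]
  rw [this]
  simp [mul_comm]

theorem lorentz_add_left (p q x : V) : lorentz (p + q) x = lorentz p x + lorentz q x := by
  simp only [lorentz_eq_inner, map_add, inner_add_left]

theorem lorentz_neg_left (p x : V) : lorentz (-p) x = -lorentz p x := by
  simp only [lorentz_eq_inner, map_neg, inner_neg_left]

theorem lorentz_sum_left {ι : Type*} (s : Finset ι) (p : ι → V) (x : V) :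
    lorentz (∑ i ∈ s, p i) x = ∑ i ∈ s, lorentz (p i) x := by
  simp only [lorentz_eq_inner, map_sum, sum_inner]

theorem continuous_lorentz : Continuous fun z : V × V => lorentz z.1 z.2 := by
  simp only [lorentz_eq_inner]
  exact (lowerIso.continuous.comp continuous_fst).inner continuous_snd

/-- The substitution `p ↦ η p / (2π)`, which relates `momRep` to the Fourier transform of
Mathlib. -/
noncomputable def momScale : V ≃L[ℝ] V :=
  lowerIso.toContinuousLinearEquiv.trans
    (ContinuousLinearEquiv.smulLeft (Units.mk0 ((2 * Real.pi)⁻¹ : ℝ) (by positivity)))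

/-- The momentum representation of a Schwartz function, as a Schwartz function. -/
noncomputable def momSchwartz (f : 𝓢(V, ℂ)) : 𝓢(V, ℂ) :=
  SchwartzMap.compCLMOfContinuousLinearEquiv ℂ momScale (𝓕 f)

theorem momSchwartz_apply (f : 𝓢(V, ℂ)) (p : V) :
    momSchwartz f p = 𝓕 f ((2 * Real.pi)⁻¹ • lowerIso p) := rfl

theorem momRep_eq (f : 𝓢(V, ℂ)) (p : V) : momRep f p = momSchwartz f p := by
  rw [momSchwartz_apply, SchwartzMap.fourier_coe, Real.fourier_eq', momRep]
  congr 1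
  funext x
  rw [lorentz_eq_inner, inner_smul_right, real_inner_comm, smul_eq_mul]
  congr 2
  push_cast
  field_simp

/-- Fourier inversion: `∫ d⁴p e^{i p·x} f(p) = (2π)⁴ f(x)`. -/
theorem integral_exp_mul_momSchwartz (f : 𝓢(V, ℂ)) (x : V) :
    ∫ p, Complex.exp (Complex.I * lorentz p x) * momSchwartz f p = (2 * Real.pi) ^ 4 * f x := by
  let G : V → ℂ := fun p => Complex.exp (↑(2 * Real.pi * inner ℝ p x) * Complex.I) • 𝓕 f p
  have h1 : ∀ p, Complex.exp (Complex.I * lorentz p x) * momSchwartz f p =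
      G ((2 * Real.pi)⁻¹ • lowerIso p) := fun p => by
    simp only [G, momSchwartz_apply, inner_smul_left, lorentz_eq_inner, smul_eq_mul]
    congr 2
    simp only [map_inv₀, conj_trivial]
    push_cast
    field_simp
  simp only [h1]
  rw [lowerIso.measurePreserving.integral_comp lowerIso.toHomeomorph.measurableEmbedding
    (fun p => G ((2 * Real.pi)⁻¹ • p)), Measure.integral_comp_smul]
  have h2 : ∫ p, G p = f x := by
    have h3 : 𝓕⁻ (𝓕 f) = f := by simp
    have h4 := congrArg (fun s : 𝓢(V, ℂ) => s x) h3
    simp only [SchwartzMap.fourierInv_coe, Real.fourierInv_eq'] at h4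
    exact h4
  rw [h2, finrank_euclideanSpace_fin, inv_pow, inv_inv, abs_of_nonneg (by positivity)]
  simp

/-- A partial derivative becomes a factor `i p_μ`, with the index lowered since the phase is
`e^{-i p·x}` in the Lorentz product. -/
theorem momSchwartz_lineDerivOp (f : 𝓢(V, ℂ)) (μ : Idx) (p : V) :
    momSchwartz (∂_{EuclideanSpace.single μ (1 : ℝ)} f) p =
      Complex.I * lowerIdx p μ * momSchwartz f p := by
  have ht : (fun x : V => inner ℝ x (EuclideanSpace.single μ (1 : ℝ))).HasTemperateGrowth := by
    fun_prop
  rw [momSchwartz_apply, SchwartzMap.fourier_lineDerivOp_eq, smul_apply,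
    SchwartzMap.smulLeftCLM_apply_apply ht, momSchwartz_apply, ← lowerIso_apply,
    inner_smul_left, EuclideanSpace.inner_single_right]
  simp only [map_inv₀, conj_trivial, one_mul, Complex.real_smul, smul_eq_mul]
  push_cast
  field_simp

/-! ### The momentum integral of a product of transforms -/

variable {n : ℕ}

theorem continuous_momSchwartz_prod (u v : 𝓢(V, ℂ)) (g : Fin n → 𝓢(V, ℂ)) :
    Continuous fun q : Momenta n =>
      momSchwartz u q.1 * momSchwartz v q.2.1 * ∏ i, momSchwartz (g i) (q.2.2 i) := by
  have h := fun f : 𝓢(V, ℂ) => (momSchwartz f).continuous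
  refine (((h u).comp continuous_fst).mul ((h v).comp (by fun_prop))).mul
    (continuous_finsetProd _ fun i _ => (h (g i)).comp (by fun_prop))

theorem continuous_solve_delta :
    Continuous fun q : V × (Fin n → V) => ((q.1, -(q.1 + ∑ i, q.2 i), q.2) : Momenta n) := by
  fun_prop

theorem integrable_momSchwartz_mul_prod (u : 𝓢(V, ℂ)) (g : Fin n → 𝓢(V, ℂ)) :
    Integrable fun q : V × (Fin n → V) => momSchwartz u q.1 * ∏ i, momSchwartz (g i) (q.2 i) :=
  (momSchwartz u).integrable.mul_prod (Integrable.fintype_prod fun i => (momSchwartz (g i)).integrable)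

/-- With the delta function solved for the second momentum, the factor `v` is bounded and the others
are integrable in independent variables. -/
theorem integrable_momMeasure_prod (u v : 𝓢(V, ℂ)) (g : Fin n → 𝓢(V, ℂ)) :
    Integrable (fun q : Momenta n =>
      momSchwartz u q.1 * momSchwartz v q.2.1 * ∏ i, momSchwartz (g i) (q.2.2 i))
      (momMeasure n) := by
  refine Integrable.smul_measure ?_ ENNReal.ofReal_ne_top
  rw [deltaMeasure, integrable_map_measure
    (continuous_momSchwartz_prod u v g).aestronglyMeasurable continuous_solve_delta.aemeasurable]
  obtain ⟨C, -, hC⟩ := (momSchwartz v).decay 0 0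
  refine ((integrable_momSchwartz_mul_prod u g).norm.mul_const C).mono'
    ((continuous_momSchwartz_prod u v g).comp continuous_solve_delta).aestronglyMeasurable
    (Filter.Eventually.of_forall fun q => ?_)
  have h := hC (-(q.1 + ∑ i, q.2 i))
  simp only [pow_zero, one_mul, norm_iteratedFDeriv_zero] at h
  simp only [Function.comp_apply, norm_mul]
  rw [mul_right_comm]
  exact mul_le_mul_of_nonneg_left h (by positivity)

/-- The momentum integral with the momentum-conserving delta function of a product of transforms is
the position-space integral of the product. -/
theorem integral_momMeasure_prod (u v : 𝓢(V, ℂ)) (g : Fin n → 𝓢(V, ℂ)) :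
    ∫ q, momSchwartz u q.1 * momSchwartz v q.2.1 * ∏ i, momSchwartz (g i) (q.2.2 i)
      ∂(momMeasure n) = ∫ x, u x * v x * ∏ i, g i x := by
  let e : V → V → ℂ := fun p x => Complex.exp (Complex.I * lorentz p x)
  have hinv : ∀ (f : 𝓢(V, ℂ)) (x : V), ∫ p, e p x * momSchwartz f p = (2 * Real.pi) ^ 4 * f x :=
    integral_exp_mul_momSchwartz
  -- Writing the transform of `v` as an integral over `x` splits the phase into one factor for each
  -- remaining momentum, and these are integrated by Fourier inversion after exchanging the integrals.
  let F : V × (Fin n → V) → V → ℂ := fun q x =>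
    (e q.1 x * momSchwartz u q.1) * (∏ i, (e (q.2 i) x * momSchwartz (g i) (q.2 i))) * v x
  have hnorm : ∀ p x, ‖e p x‖ = 1 := fun p x => by
    simp only [e]
    rw [mul_comm]
    exact Complex.norm_exp_ofReal_mul_I _
  have hF : ∀ q : V × (Fin n → V), momSchwartz u q.1 * momSchwartz v (-(q.1 + ∑ i, q.2 i)) *
      ∏ i, momSchwartz (g i) (q.2 i) = ∫ x, F q x := fun q => by
    rw [← momRep_eq v, momRep, mul_right_comm, ← integral_const_mul]
    congr 1
    funext x
    have h1 : Complex.exp (-(Complex.I * lorentz (-(q.1 + ∑ i, q.2 i)) x)) =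
        e q.1 x * ∏ i, e (q.2 i) x := by
      simp only [e]
      rw [← Complex.exp_sum, ← Complex.exp_add, lorentz_neg_left, lorentz_add_left,
        lorentz_sum_left]
      congr 1
      push_cast
      rw [← Finset.mul_sum]
      ring
    simp only [h1, F, Finset.prod_mul_distrib]
    ring
  have he : Continuous fun z : V × V => e z.1 z.2 := by
    refine Complex.continuous_exp.comp (continuous_const.mul ?_)
    exact Complex.continuous_ofReal.comp continuous_lorentz
  have hcont : Continuous (Function.uncurry F) := by
    have h := fun f : 𝓢(V, ℂ) => (momSchwartz f).continuous
    refine Continuous.mul (Continuous.mul ?_ (continuous_finsetProd _ fun i _ => ?_))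
      (v.continuous.comp continuous_snd)
    · exact (he.comp (by fun_prop : Continuous fun z : (V × (Fin n → V)) × V => (z.1.1, z.2))).mul
        ((h u).comp (by fun_prop))
    · exact (he.comp (by fun_prop : Continuous fun z : (V × (Fin n → V)) × V =>
        (z.1.2 i, z.2))).mul ((h (g i)).comp (by fun_prop))
  have hint : Integrable (Function.uncurry F)
      ((volume : Measure (V × (Fin n → V))).prod (volume : Measure V)) := by
    refine ((integrable_momSchwartz_mul_prod u g).mul_prod v.integrable).mono
      hcont.aestronglyMeasurable (Filter.Eventually.of_forall fun z => le_of_eq ?_)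
    simp only [Function.uncurry, F, norm_mul, norm_prod, hnorm, one_mul]
  have hq : ∀ x, ∫ q, F q x = ((2 * Real.pi) ^ 4) ^ (n + 1) * (u x * v x * ∏ i, g i x) := fun x => by
    simp only [F]
    rw [integral_mul_const]
    have h1 : ∫ q : V × (Fin n → V), (e q.1 x * momSchwartz u q.1) *
        (∏ i, (e (q.2 i) x * momSchwartz (g i) (q.2 i))) =
        (∫ p, e p x * momSchwartz u p) *
          ∫ k : Fin n → V, ∏ i, (e (k i) x * momSchwartz (g i) (k i)) :=
      integral_prod_mul (fun p => e p x * momSchwartz u p)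
        fun k : Fin n → V => ∏ i, (e (k i) x * momSchwartz (g i) (k i))
    rw [h1, integral_fintype_prod_volume_eq_prod (fun i p => e p x * momSchwartz (g i) p)]
    simp only [hinv, Finset.prod_mul_distrib, Finset.prod_const, Finset.card_univ, Fintype.card_fin]
    ring
  rw [momMeasure, integral_smul_measure, deltaMeasure, integral_map
    continuous_solve_delta.aemeasurable (continuous_momSchwartz_prod u v g).aestronglyMeasurable]
  simp only [hF]
  rw [integral_integral_swap hint]
  simp only [hq]
  rw [integral_const_mul, ENNReal.toReal_ofReal (by positivity), Complex.real_smul, ← mul_assoc]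
  have hpi : (Real.pi : ℂ) ≠ 0 := Complex.ofReal_ne_zero.2 Real.pi_ne_zero
  have hc : (((1 / (2 * Real.pi) ^ 4) ^ (n + 2) * (2 * Real.pi) ^ 4 : ℝ) : ℂ) *
      ((2 * Real.pi) ^ 4) ^ (n + 1) = 1 := by
    push_cast
    rw [one_div, inv_pow, pow_succ _ (n + 1)]
    field_simp
  rw [hc, one_mul]

end Momentum

section Geometry

open scoped Matrix.Norms.Operator

variable {w : Matrix Idx Idx ℝ} {θ : ℝ}

/-! ### The metric `η + w` for a small symmetric `w` -/

theorem det_eta : eta.det = -1 := by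
  simp [eta, Fin.prod_univ_four]

theorem mul_eta_apply (A : Matrix Idx Idx ℝ) (μ ν : Idx) : (A * eta) μ ν = A μ ν * eta ν ν := by
  rw [eta, Matrix.mul_diagonal, Matrix.diagonal_apply_eq]

theorem eta_mul_apply (A : Matrix Idx Idx ℝ) (μ ν : Idx) : (eta * A) μ ν = eta μ μ * A μ ν := by
  rw [eta, Matrix.diagonal_mul, Matrix.diagonal_apply_eq]

theorem abs_eta_self (μ : Idx) : |eta μ μ| = 1 := by
  fin_cases μ <;> simp [eta]

theorem norm_mul_eta_le (hθ : 0 ≤ θ) (hw : ∀ μ, ∑ ν, |w μ ν| ≤ θ) : ‖w * eta‖ ≤ θ := by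
  refine norm_le_of_forall_sum_le _ hθ fun μ => ?_
  simpa only [mul_eta_apply, abs_mul, abs_eta_self, mul_one] using hw μ

theorem eta_add_eq (w : Matrix Idx Idx ℝ) : eta + w = (1 + w * eta) * eta := by
  rw [Matrix.add_mul, Matrix.one_mul, Matrix.mul_assoc, eta_mul_eta, Matrix.mul_one]

theorem inv_eta_add (w : Matrix Idx Idx ℝ) : (eta + w)⁻¹ = eta * (1 + w * eta)⁻¹ := by
  rw [eta_add_eq, Matrix.mul_inv_rev, Matrix.inv_eq_right_inv eta_mul_eta]

theorem neg_det_eta_add (w : Matrix Idx Idx ℝ) : -(eta + w).det = (1 + w * eta).det := by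
  rw [eta_add_eq, Matrix.det_mul, det_eta]
  ring

theorem norm_pow_entry_le (hX : ‖w * eta‖ ≤ θ) (k : ℕ) (μ ν : Idx) :
    |((w * eta) ^ k) μ ν| ≤ θ ^ k := by
  refine (abs_entry_le_norm _ μ ν).trans ((norm_pow_le _ k).trans ?_)
  exact pow_le_pow_left₀ (norm_nonneg _) hX k

theorem norm_eta_mul_pow_entry_le (hX : ‖w * eta‖ ≤ θ) (k : ℕ) (μ ν : Idx) :
    |(-1) ^ k * (eta * (w * eta) ^ k) μ ν| ≤ θ ^ k := by
  rw [eta_mul_apply, abs_mul, abs_mul, abs_eta_self, abs_pow, abs_neg, abs_one, one_pow, one_mul,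
    one_mul]
  exact norm_pow_entry_le hX k μ ν

theorem abs_halfLogTr_le (hX : ‖w * eta‖ ≤ θ) (k : ℕ) : |halfLogTr w k| ≤ 2 * θ ^ k := by
  rcases k with _ | k
  · simp [halfLogTr]
  have h := abs_trace_pow_le hX k
  rw [Fintype.card_fin] at h
  rw [halfLogTr, abs_mul, abs_div, abs_pow, abs_neg, abs_one, one_pow,
    abs_of_pos (by positivity : (0 : ℝ) < 2 * ((k + 1 : ℕ) : ℝ))]
  have h2 : 1 / (2 * ((k + 1 : ℕ) : ℝ)) ≤ 1 / 2 := by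
    apply one_div_le_one_div_of_le (by norm_num)
    push_cast
    linarith [(Nat.cast_nonneg k : (0 : ℝ) ≤ k)]
  calc _ ≤ 1 / 2 * ((4 : ℕ) * θ ^ (k + 1)) :=
        mul_le_mul h2 h (abs_nonneg _) (by norm_num)
    _ = _ := by push_cast; ring

/-- `√(-det (η + w)) = exp (½ tr log (1 + wη))`. -/
theorem sqrt_neg_det_eta_add (hX : ‖w * eta‖ < 1) :
    Real.sqrt (-(eta + w).det) = Real.exp (∑' k, halfLogTr w (k + 1)) := by
  rw [neg_det_eta_add, ← exp_tsum_trace_pow hX, Real.sqrt_eq_iff_mul_self_eq (Real.exp_pos _).le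
    (Real.exp_pos _).le, ← Real.exp_add, ← two_mul, ← tsum_mul_left]
  congr 2
  funext k
  rw [halfLogTr]
  push_cast
  field_simp
  ring

theorem summable_two_mul_pow_succ (h0 : 0 ≤ θ) (hθ : θ < 1) :
    Summable fun k : ℕ => 2 * θ ^ (k + 1) :=
  Summable.mul_left 2 ((summable_nat_add_iff 1).2 (summable_geometric_of_lt_one h0 hθ))

theorem hasSum_contr_tensorC (hw : w.IsSymm) (hX : ‖w * eta‖ ≤ θ) (hθ : θ < 1) :
    HasSum (fun n => contr w (tensorC (n := n))) (Real.sqrt (-(eta + w).det)) := by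
  have h0 : 0 ≤ θ := (norm_nonneg _).trans hX
  rw [sqrt_neg_det_eta_add (hX.trans_lt hθ)]
  simp only [contr_tensorC hw]
  refine hasSum_expCoeff (Summable.of_nonneg_of_le (fun _ => norm_nonneg _)
    (fun k => abs_halfLogTr_le hX (k + 1)) (summable_two_mul_pow_succ h0 hθ))

theorem hasSum_inv_eta_add (hX : ‖w * eta‖ < 1) (μ ν : Idx) :
    HasSum (fun k : ℕ => (-1) ^ k * (eta * (w * eta) ^ k) μ ν) ((eta + w)⁻¹ μ ν) := by
  rw [inv_eta_add]
  refine (hasSum_entry ((hasSum_neg_pow hX).mul_left eta) μ ν).congr_fun fun k => ?_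
  rw [Matrix.mul_smul, Matrix.smul_apply, smul_eq_mul]

/-! ### Majorants and the sums of the contracted series -/

/-- Factors majorizing those of the contracted `C` tensors: the coefficients of
`exp (∑ 2 θ^k t^k)`, and `m` geometric series. -/
noncomputable def majorantFactor (θ : ℝ) (m : ℕ) : Fin (m + 1) → ℕ → ℝ :=
  Fin.cons (expCoeff fun k => 2 * θ ^ k) fun _ k => θ ^ k

/-- The Cauchy product of the factors `majorantFactor`. -/
noncomputable def majorant (θ : ℝ) (m n : ℕ) : ℝ :=
  ∑ k ∈ Finset.Nat.antidiagonalTuple (m + 1) n, ∏ i, majorantFactor θ m i (k i)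

theorem summable_norm_majorantFactor (h0 : 0 ≤ θ) (hθ : θ < 1) (m : ℕ) (i : Fin (m + 1)) :
    Summable fun k => ‖majorantFactor θ m i k‖ := by
  refine Fin.cases ?_ (fun i => ?_) i
  · exact (hasSum_expCoeff (a := fun k => 2 * θ ^ k)
      (summable_two_mul_pow_succ h0 hθ).norm).summable.norm
  · exact (summable_geometric_of_lt_one h0 hθ).norm

theorem summable_majorant (h0 : 0 ≤ θ) (hθ : θ < 1) (m : ℕ) : Summable (majorant θ m) :=
  (hasSum_antidiagonalTuple _ (summable_norm_majorantFactor h0 hθ m)).summable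

theorem abs_le_majorantFactor (hX : ‖w * eta‖ ≤ θ) {m : ℕ} {P : Fin m → ℕ → ℝ}
    (hP : ∀ i k, |P i k| ≤ θ ^ k) (i : Fin (m + 1)) (k : ℕ) :
    |(Fin.cons (expCoeff (halfLogTr w)) P : Fin (m + 1) → ℕ → ℝ) i k| ≤
      majorantFactor θ m i k := by
  refine Fin.cases ?_ (fun i => ?_) i
  · exact abs_expCoeff_le (abs_halfLogTr_le hX) k
  · exact hP i k

/-- The Cauchy product of the series of `√(-det (η + w))` with `m` series dominated by
geometric ones. -/
theorem hasSum_cons_expCoeff (hw : w.IsSymm) (hX : ‖w * eta‖ ≤ θ) (hθ : θ < 1) {m : ℕ}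
    {P : Fin m → ℕ → ℝ} (hP : ∀ i k, |P i k| ≤ θ ^ k) {a : Fin m → ℝ}
    (ha : ∀ i, HasSum (P i) (a i)) :
    HasSum (fun n => ∑ k ∈ Finset.Nat.antidiagonalTuple (m + 1) n,
        expCoeff (halfLogTr w) (k 0) * ∏ i : Fin m, P i (k i.succ))
      (Real.sqrt (-(eta + w).det) * ∏ i, a i) := by
  have h0 : 0 ≤ θ := (norm_nonneg _).trans hX
  have h := hasSum_antidiagonalTuple (Fin.cons (expCoeff (halfLogTr w)) P) fun i =>
    Summable.of_nonneg_of_le (fun _ => norm_nonneg _) (abs_le_majorantFactor hX hP i)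
      (summable_norm_majorantFactor h0 hθ m i).of_norm
  have h1 := hasSum_contr_tensorC hw hX hθ
  simp only [contr_tensorC hw] at h1
  simp only [Fin.prod_univ_succ, Fin.cons_zero, Fin.cons_succ, (ha _).tsum_eq] at h
  rwa [h1.tsum_eq] at h

theorem abs_cons_expCoeff_le (hX : ‖w * eta‖ ≤ θ) {m : ℕ}
    {P : Fin m → ℕ → ℝ} (hP : ∀ i k, |P i k| ≤ θ ^ k) (n : ℕ) :
    |∑ k ∈ Finset.Nat.antidiagonalTuple (m + 1) n,
        expCoeff (halfLogTr w) (k 0) * ∏ i : Fin m, P i (k i.succ)| ≤ majorant θ m n := by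
  have h := abs_sum_antidiagonalTuple_le (abs_le_majorantFactor hX hP) n
  simp only [Fin.prod_univ_succ (n := m), Fin.cons_zero, Fin.cons_succ] at h
  refine h.trans (le_of_eq ?_)
  simp only [majorant, Fin.prod_univ_succ (n := m)]

/-- A family of tensors whose contractions with `w` sum to `W`, uniformly dominated over all
symmetric `w` with row sums at most `θ`. -/
structure Resums (C : ∀ n, (Fin n → Idx × Idx) → ℝ) (W : Matrix Idx Idx ℝ → ℝ) : Prop where
  hasSum : ∀ w : Matrix Idx Idx ℝ, w.IsSymm → ‖w * eta‖ < 1 →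
    HasSum (fun n => contr w (C n)) (W w)
  dominated : ∀ θ : ℝ, 0 ≤ θ → θ < 1 → ∃ b : ℕ → ℝ, Summable b ∧
    ∀ w : Matrix Idx Idx ℝ, w.IsSymm → ‖w * eta‖ ≤ θ → ∀ n, |contr w (C n)| ≤ b n

/-- Tensors whose contractions are Cauchy products of the series of `√(-g)` with `m` series dominated
by the geometric one. -/
theorem Resums.of_cauchy {C : ∀ n, (Fin n → Idx × Idx) → ℝ} {W : Matrix Idx Idx ℝ → ℝ} {m : ℕ}
    (P : Matrix Idx Idx ℝ → Fin m → ℕ → ℝ) (a : Matrix Idx Idx ℝ → Fin m → ℝ)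
    (hP : ∀ (w : Matrix Idx Idx ℝ) (θ : ℝ), ‖w * eta‖ ≤ θ → ∀ i k, |P w i k| ≤ θ ^ k)
    (ha : ∀ w : Matrix Idx Idx ℝ, ‖w * eta‖ < 1 → ∀ i, HasSum (P w i) (a w i))
    (hC : ∀ w : Matrix Idx Idx ℝ, w.IsSymm → ∀ n, contr w (C n) =
      ∑ k ∈ Finset.Nat.antidiagonalTuple (m + 1) n,
        expCoeff (halfLogTr w) (k 0) * ∏ i : Fin m, P w i (k i.succ))
    (hW : ∀ w, W w = Real.sqrt (-(eta + w).det) * ∏ i, a w i) : Resums C W where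
  hasSum w hw hX := by
    rw [hW]
    simp only [hC w hw]
    exact hasSum_cons_expCoeff hw le_rfl hX (hP w _ le_rfl) (ha w hX)
  dominated θ h0 hθ := ⟨majorant θ m, summable_majorant h0 hθ m, fun w hw hX n => by
    rw [hC w hw]
    exact abs_cons_expCoeff_le hX (hP w θ hX) n⟩

theorem resums_tensorCI (μ ν : Idx) : Resums (fun n => tensorCI μ ν (n := n))
    fun w => Real.sqrt (-(eta + w).det) * (eta + w)⁻¹ μ ν :=
  Resums.of_cauchy (m := 1) (fun w _ k => (-1) ^ k * (eta * (w * eta) ^ k) μ ν)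
    (fun w _ => (eta + w)⁻¹ μ ν) (fun _ _ hX _ k => norm_eta_mul_pow_entry_le hX k μ ν)
    (fun _ hX _ => hasSum_inv_eta_add hX μ ν)
    (fun w hw n => by rw [contr_tensorCI hw]; simp) (fun w => by simp)

theorem resums_tensorCII (μ ν α β : Idx) : Resums (fun n => tensorCII μ ν α β (n := n))
    fun w => Real.sqrt (-(eta + w).det) * ((eta + w)⁻¹ μ ν * (eta + w)⁻¹ α β) :=
  Resums.of_cauchy (m := 2)
    (fun w i k => (-1) ^ k * (eta * (w * eta) ^ k) (![μ, α] i) (![ν, β] i))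
    (fun w i => (eta + w)⁻¹ (![μ, α] i) (![ν, β] i))
    (fun _ _ hX _ k => norm_eta_mul_pow_entry_le hX k _ _)
    (fun _ hX _ => hasSum_inv_eta_add hX _ _)
    (fun w hw n => by
      rw [contr_tensorCII hw]
      refine Finset.sum_congr rfl fun k _ => ?_
      rw [Fin.prod_univ_two, mul_assoc]
      rfl)
    (fun w => by rw [Fin.prod_univ_two]; rfl)

theorem resums_tensorCIII (μ ν α β l τ : Idx) : Resums (fun n => tensorCIII μ ν α β l τ (n := n))
    fun w => Real.sqrt (-(eta + w).det) *
      ((eta + w)⁻¹ μ ν * (eta + w)⁻¹ α β * (eta + w)⁻¹ l τ) :=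
  Resums.of_cauchy (m := 3)
    (fun w i k => (-1) ^ k * (eta * (w * eta) ^ k) (![μ, α, l] i) (![ν, β, τ] i))
    (fun w i => (eta + w)⁻¹ (![μ, α, l] i) (![ν, β, τ] i))
    (fun _ _ hX _ k => norm_eta_mul_pow_entry_le hX k _ _)
    (fun _ hX _ => hasSum_inv_eta_add hX _ _)
    (fun w hw n => by
      rw [contr_tensorCIII hw]
      refine Finset.sum_congr rfl fun k _ => ?_
      rw [Fin.prod_univ_three]
      have h4 : ∀ a b c d : ℝ, a * b * c * d = a * (b * c * d) := fun a b c d => by ring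
      exact h4 _ _ _ _)
    (fun w => by rw [Fin.prod_univ_three]; rfl)

theorem resums_tensorCE (μ ν : Idx) : Resums (fun n => tensorCE μ ν (n := n))
    fun w => Real.sqrt (-(eta + w).det) * invSqrtOneAdd (w * eta) μ ν :=
  Resums.of_cauchy (m := 1) (fun w _ k => Ring.choose (-(1 / 2) : ℝ) k * ((w * eta) ^ k) μ ν)
    (fun w _ => invSqrtOneAdd (w * eta) μ ν)
    (fun w θ hX _ k => by
      rw [abs_mul, ← one_mul (θ ^ k)]
      exact mul_le_mul (abs_choose_neg_half_le_one k) (norm_pow_entry_le hX k μ ν) (abs_nonneg _)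
        zero_le_one)
    (fun _ hX _ => by
      simpa only [Matrix.smul_apply, smul_eq_mul] using hasSum_entry (hasSum_invSqrtOneAdd hX) μ ν)
    (fun w hw n => by rw [contr_tensorCE hw]; simp) (fun w => by simp)

/-! ### The vierbein -/

theorem isSymm_invSqrtOneAdd_mul_eta (hw : w.IsSymm) (hX : ‖w * eta‖ < 1) :
    (invSqrtOneAdd (w * eta) * eta).IsSymm := by
  have h := (hasSum_invSqrtOneAdd hX).mul_right eta
  have hk : ∀ k : ℕ, ((w * eta) ^ k * eta).IsSymm := fun k => by
    have h1 : (w * eta) ^ k * eta = eta * (eta * (w * eta) ^ k) * eta := by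
      rw [← Matrix.mul_assoc eta eta, eta_mul_eta, Matrix.one_mul]
    rw [Matrix.IsSymm, h1, Matrix.transpose_mul, Matrix.transpose_mul,
      (isSymm_eta_mul_pow hw k).eq, eta_isSymm.eq]
    simp only [Matrix.mul_assoc]
  refine Matrix.IsSymm.ext fun μ ν => ?_
  refine (hasSum_entry h ν μ).unique ((hasSum_entry h μ ν).congr_fun fun k => ?_)
  rw [Matrix.smul_mul, Matrix.smul_apply, Matrix.smul_apply, (hk k).apply]

theorem metric_eq (κ : ℝ) (h : Idx → Idx → 𝓢(V, ℝ)) (x : V) :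
    metric κ h x = eta + Matrix.of fun μ ν => κ * h μ ν x := rfl

theorem sum_sum_mul_eq_mul_mul_transpose (e g : Matrix Idx Idx ℝ) (μ ν : Idx) :
    ∑ α, ∑ β, e μ α * e ν β * g α β = (e * g * e.transpose) μ ν := by
  simp only [Matrix.mul_apply, Matrix.transpose_apply, Finset.sum_mul]
  rw [Finset.sum_comm]
  refine Finset.sum_congr rfl fun _ _ => Finset.sum_congr rfl fun _ _ => ?_
  ring

/-- The binomial series `(1 + κhη)^{-1/2}` is a vierbein. -/
theorem isVierbein_invSqrtOneAdd {κ : ℝ} {h : Idx → Idx → 𝓢(V, ℝ)}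
    (hw : ∀ x, (Matrix.of fun μ ν => κ * h μ ν x).IsSymm)
    (hX : ∀ x, ‖(Matrix.of fun μ ν => κ * h μ ν x) * eta‖ < 1) :
    IsVierbein κ h fun x => invSqrtOneAdd ((Matrix.of fun μ ν => κ * h μ ν x) * eta) where
  flat x μ ν := by
    rw [sum_sum_mul_eq_mul_mul_transpose, metric_eq]
    generalize hw' : (Matrix.of fun μ ν => κ * h μ ν x) = w at *
    have hX' := hX x
    have hs := hw x
    rw [hw'] at hX' hs
    have hs := isSymm_invSqrtOneAdd_mul_eta hs hX'
    set T := invSqrtOneAdd (w * eta) with hT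
    have h1 : eta * T.transpose = T * eta := by
      have := hs.eq
      rwa [Matrix.transpose_mul, eta_isSymm.eq] at this
    have hc : T * (1 + w * eta) = (1 + w * eta) * T :=
      ((Commute.one_left T).add_left (Commute.invSqrtOneAdd_right hX' (Commute.refl _))).symm
    rw [eta_add_eq, ← Matrix.mul_assoc, hc, Matrix.mul_assoc _ eta, h1, ← Matrix.mul_assoc,
      Matrix.mul_assoc _ T T, hT, invSqrtOneAdd_mul_self hX',
      Matrix.mul_nonsing_inv _ (isUnit_det_one_add hX'), Matrix.one_mul]
  curved x α β := by
    have hr := sum_sum_mul_eq_mul_mul_transpose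
      (invSqrtOneAdd ((Matrix.of fun μ ν => κ * h μ ν x) * eta)).transpose eta α β
    simp only [Matrix.transpose_apply, Matrix.transpose_transpose] at hr
    rw [hr, invMetric, metric_eq, inv_eta_add]
    have hs := (isSymm_invSqrtOneAdd_mul_eta (hw x) (hX x)).eq
    rw [Matrix.transpose_mul, eta_isSymm.eq] at hs
    have h2 := congrArg (eta * ·) hs
    simp only [← Matrix.mul_assoc, eta_mul_eta, Matrix.one_mul] at h2
    rw [← invSqrtOneAdd_mul_self (hX x), ← Matrix.mul_assoc eta, h2, Matrix.mul_assoc _ eta eta,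
      eta_mul_eta, Matrix.mul_one]
  symmetric x := isSymm_invSqrtOneAdd_mul_eta (hw x) (hX x)
  principal x _ hz := re_spectrum_invSqrtOneAdd_pos (hX x) hz

/-- In the symmetric gauge `e g eᵀ = η` reads `e (1 + κhη) e = 1`, so the vierbein is the principal
square root of `(1 + κhη)⁻¹`. -/
theorem IsVierbein.eq_invSqrtOneAdd {κ : ℝ} {h : Idx → Idx → 𝓢(V, ℝ)}
    {e : V → Matrix Idx Idx ℝ} (he : IsVierbein κ h e) {x : V}
    (hX : ‖(Matrix.of fun μ ν => κ * h μ ν x) * eta‖ < 1) :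
    e x = invSqrtOneAdd ((Matrix.of fun μ ν => κ * h μ ν x) * eta) := by
  refine FeynGrav.eq_invSqrtOneAdd hX ?_ (he.principal x)
  have hs := (he.symmetric x).eq
  rw [Matrix.transpose_mul, eta_isSymm.eq] at hs
  have hf : e x * metric κ h x * (e x).transpose = eta := by
    ext μ ν
    rw [← sum_sum_mul_eq_mul_mul_transpose, he.flat]
  rw [metric_eq, eta_add_eq, ← Matrix.mul_assoc, Matrix.mul_assoc _ eta, hs,
    ← Matrix.mul_assoc] at hf
  have h1 : e x * ((1 + (Matrix.of fun μ ν => κ * h μ ν x) * eta) * e x) = 1 := by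
    have := congrArg (· * eta) hf
    simp only [Matrix.mul_assoc, eta_mul_eta, Matrix.mul_one] at this
    exact this
  rw [mul_eq_one_comm] at h1
  refine (Matrix.inv_eq_right_inv ?_).symm
  rw [← Matrix.mul_assoc]
  exact h1

/-! ### Uniform smallness -/

/-- Since `h` vanishes at infinity, the pointwise bound on the row sums of `κ h` improves to a
uniform one. -/
theorem exists_uniform_bound {κ : ℝ} {h : Idx → Idx → 𝓢(V, ℝ)} (hκ : 0 < κ)
    (hsmall : ∀ x μ, κ * ∑ ν, |h μ ν x| < 1) :
    ∃ θ : ℝ, 0 ≤ θ ∧ θ < 1 ∧ ∀ x, ‖(Matrix.of fun μ ν => κ * h μ ν x) * eta‖ ≤ θ := by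
  have hrow : ∀ μ, ∃ θ : ℝ, 0 ≤ θ ∧ θ < 1 ∧ ∀ x, κ * ∑ ν, |h μ ν x| ≤ θ := by
    intro μ
    have hcont : Continuous fun x => κ * ∑ ν, |h μ ν x| :=
      continuous_const.mul (continuous_finsetSum _ fun ν _ => (h μ ν).continuous.abs)
    have hlim : Filter.Tendsto (fun x => κ * ∑ ν, |h μ ν x|) (Filter.cocompact V) (nhds 0) := by
      have h1 : Filter.Tendsto (fun x => κ * ∑ ν, |h μ ν x|) (Filter.cocompact V)
          (nhds (κ * ∑ _ν : Idx, |(0 : ℝ)|)) :=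
        (tendsto_finsetSum _ fun ν _ => (h μ ν).tendsto_cocompact.abs).const_mul κ
      simpa using h1
    have hev := hlim.eventually (gt_mem_nhds (by norm_num : (0 : ℝ) < 1 / 2))
    obtain ⟨K, hK, hKc⟩ := Filter.mem_cocompact.1 hev
    -- Outside `K` the function is below `1 / 2`; on `K` it attains its maximum. Adding the point `0`
    -- makes the compact set nonempty.
    obtain ⟨y, -, hy⟩ := (hK.union (isCompact_singleton (x := (0 : V)))).exists_isMaxOn
      ⟨0, Or.inr rfl⟩ hcont.continuousOn
    refine ⟨max (1 / 2) (κ * ∑ ν, |h μ ν y|), le_max_of_le_left (by norm_num),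
      max_lt (by norm_num) (hsmall y μ), fun x => ?_⟩
    by_cases hx : x ∈ K
    · exact le_max_of_le_right (hy (Or.inl hx))
    · exact le_max_of_le_left (hKc hx).le
  choose θ h0 h1 h2 using hrow
  refine ⟨Finset.univ.sup' Finset.univ_nonempty θ,
    (h0 0).trans (Finset.le_sup' θ (Finset.mem_univ 0)),
    (Finset.sup'_lt_iff _).2 fun μ _ => h1 μ, fun x => ?_⟩
  refine norm_mul_eta_le ((h0 0).trans (Finset.le_sup' θ (Finset.mem_univ 0))) fun μ => ?_
  refine le_trans (le_of_eq ?_) ((h2 μ x).trans (Finset.le_sup' θ (Finset.mem_univ μ)))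
  simp only [Matrix.of_apply, abs_mul, abs_of_pos hκ, Finset.mul_sum]

end Geometry

/-! ### Actions with a momentum-space expansion -/

/-- The Lagrangian `L` is integrable, the `n`-graviton terms `T n` are integrable over the
momenta, and their integrals sum to the action `∫ L`. -/
structure Expands (L : V → ℂ) (T : ∀ n, Momenta n → ℂ) : Prop where
  integrable : Integrable L
  integrable_term : ∀ n, Integrable (T n) (momMeasure n)
  hasSum : HasSum (fun n => ∫ q, T n q ∂(momMeasure n)) (∫ x, L x)

namespace Expands

variable {L L' : V → ℂ} {T T' : ∀ n, Momenta n → ℂ}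

theorem congr (h : Expands L T) (hL : ∀ x, L' x = L x) (hT : ∀ n q, T' n q = T n q) :
    Expands L' T' := by
  obtain rfl : L' = L := funext hL
  obtain rfl : T' = T := funext fun n => funext (hT n)
  exact h

theorem add (h : Expands L T) (h' : Expands L' T') :
    Expands (fun x => L x + L' x) fun n q => T n q + T' n q where
  integrable := h.integrable.add h'.integrable
  integrable_term n := (h.integrable_term n).add (h'.integrable_term n)
  hasSum := by
    rw [integral_add h.integrable h'.integrable]
    exact (h.hasSum.add h'.hasSum).congr_fun fun n =>
      integral_add (h.integrable_term n) (h'.integrable_term n)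

theorem const_mul (h : Expands L T) (c : ℂ) :
    Expands (fun x => c * L x) fun n q => c * T n q where
  integrable := h.integrable.const_mul c
  integrable_term n := (h.integrable_term n).const_mul c
  hasSum := by
    rw [integral_const_mul]
    exact (h.hasSum.mul_left c).congr_fun fun n => integral_const_mul c _

theorem sum {ι : Type*} (s : Finset ι) {L : ι → V → ℂ} {T : ι → ∀ n, Momenta n → ℂ}
    (h : ∀ i ∈ s, Expands (L i) (T i)) :
    Expands (fun x => ∑ i ∈ s, L i x) fun n q => ∑ i ∈ s, T i n q where
  integrable := integrable_finsetSum s fun i hi => (h i hi).integrable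
  integrable_term n := integrable_finsetSum s fun i hi => (h i hi).integrable_term n
  hasSum := by
    rw [integral_finsetSum s fun i hi => (h i hi).integrable]
    exact (hasSum_sum fun i hi => (h i hi).hasSum).congr_fun fun n =>
      integral_finsetSum s fun i hi => (h i hi).integrable_term n

end Expands

/-- A real Schwartz function as a complex one. -/
noncomputable def toComplex (f : 𝓢(V, ℝ)) : 𝓢(V, ℂ) := f.postcompCLM Complex.ofRealCLM

theorem toComplex_apply (f : 𝓢(V, ℝ)) (x : V) : toComplex f x = f x := rfl

theorem hMom_eq (h : Idx → Idx → 𝓢(V, ℝ)) (ρ σ : Idx) (k : V) :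
    hMom h ρ σ k = momSchwartz (toComplex (h ρ σ)) k :=
  momRep_eq (toComplex (h ρ σ)) k

open scoped Matrix.Norms.Operator in
/-- The smallness hypotheses on the graviton field, in the form used for the expansions. -/
structure IsSmall (κ : ℝ) (h : Idx → Idx → 𝓢(V, ℝ)) : Prop where
  isSymm : ∀ x, (Matrix.of fun μ ν => κ * h μ ν x).IsSymm
  bound : ∃ θ : ℝ, 0 ≤ θ ∧ θ < 1 ∧ ∀ x, ‖(Matrix.of fun μ ν => κ * h μ ν x) * eta‖ ≤ θ

theorem contr_graviton (κ : ℝ) (h : Idx → Idx → 𝓢(V, ℝ)) {n : ℕ} (C : (Fin n → Idx × Idx) → ℝ)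
    (x : V) : (contr (Matrix.of fun μ ν => κ * h μ ν x) C : ℂ) =
      (κ : ℂ) ^ n * ∑ r, (C r : ℂ) * ∏ i, toComplex (h (r i).1 (r i).2) x := by
  simp only [contr, Matrix.of_apply, Finset.prod_mul_distrib, Finset.prod_const, Finset.card_univ,
    Fintype.card_fin, toComplex_apply]
  push_cast
  rw [Finset.mul_sum]
  refine Finset.sum_congr rfl fun r _ => ?_
  ring

/-- The basic expansion: a function of the metric that is resummed by the tensors `C`, times a
product of two Schwartz functions. -/
theorem Resums.expands {C : ∀ n, (Fin n → Idx × Idx) → ℝ} {W : Matrix Idx Idx ℝ → ℝ}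
    (hCW : Resums C W) {κ : ℝ} {h : Idx → Idx → 𝓢(V, ℝ)} (hs : IsSmall κ h) (u v : 𝓢(V, ℂ)) :
    Expands (fun x => (W (Matrix.of fun μ ν => κ * h μ ν x) : ℂ) * (u x * v x))
      fun n q => (κ : ℂ) ^ n * ∑ r, (C n r : ℂ) * gravitons h r q.2.2 *
        (momSchwartz u q.1 * momSchwartz v q.2.1) := by
  obtain ⟨θ, h0, h1, hθ⟩ := hs.bound
  obtain ⟨b, hb, hCb⟩ := hCW.dominated θ h0 h1
  have hsum : ∀ x, HasSum (fun n => contr (Matrix.of fun μ ν => κ * h μ ν x) (C n))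
      (W (Matrix.of fun μ ν => κ * h μ ν x)) := fun x =>
    hCW.hasSum _ (hs.isSymm x) ((hθ x).trans_lt h1)
  have hle : ∀ x n, |contr (Matrix.of fun μ ν => κ * h μ ν x) (C n)| ≤ b n := fun x n =>
    hCb _ (hs.isSymm x) (hθ x) n
  have hb0 : ∀ n, 0 ≤ b n := fun n => (abs_nonneg _).trans (hle 0 n)
  let F : ℕ → V → ℂ := fun n x => (contr (Matrix.of fun μ ν => κ * h μ ν x) (C n) : ℂ) * (u x * v x)
  have hFcont : ∀ n, Continuous (F n) := fun n => by
    simp only [F, contr_graviton]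
    refine Continuous.mul (continuous_const.mul (continuous_finsetSum _ fun r _ =>
      continuous_const.mul (continuous_finsetProd _ fun i _ => ?_))) (u.continuous.mul v.continuous)
    exact (toComplex _).continuous
  have huv : Integrable fun x => u x * v x := by
    obtain ⟨K, -, hK⟩ := v.decay 0 0
    simp only [pow_zero, one_mul, norm_iteratedFDeriv_zero] at hK
    exact u.integrable.mul_bdd v.continuous.aestronglyMeasurable
      (Filter.Eventually.of_forall hK)
  have hFle : ∀ n x, ‖F n x‖ ≤ b n * ‖u x * v x‖ := fun n x => by
    rw [norm_mul, Complex.norm_real, Real.norm_eq_abs]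
    exact mul_le_mul_of_nonneg_right (hle x n) (norm_nonneg _)
  have hFsum : ∀ x, HasSum (fun n => F n x)
      ((W (Matrix.of fun μ ν => κ * h μ ν x) : ℂ) * (u x * v x)) := fun x =>
    (Complex.hasSum_ofReal.2 (hsum x)).mul_right _
  have hbsum : ∀ x, Summable fun n => b n * ‖u x * v x‖ := fun x => hb.mul_right _
  have hbint : Integrable fun x => ∑' n, b n * ‖u x * v x‖ := by
    simp only [tsum_mul_right]
    exact huv.norm.const_mul _
  have hterm : ∀ n (r : Fin n → Idx × Idx) (q : Momenta n),
      (C n r : ℂ) * gravitons h r q.2.2 * (momSchwartz u q.1 * momSchwartz v q.2.1) =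
      (C n r : ℂ) * (momSchwartz u q.1 * momSchwartz v q.2.1 *
        ∏ i, momSchwartz (toComplex (h (r i).1 (r i).2)) (q.2.2 i)) := fun n r q => by
    simp only [gravitons, hMom_eq]
    ring
  have hint : ∀ n (r : Fin n → Idx × Idx), Integrable (fun q : Momenta n =>
      (C n r : ℂ) * gravitons h r q.2.2 * (momSchwartz u q.1 * momSchwartz v q.2.1))
      (momMeasure n) := fun n r => by
    simp only [hterm]
    exact (integrable_momMeasure_prod u v _).const_mul _
  refine ⟨?_, fun n => (integrable_finsetSum _ fun r _ => hint n r).const_mul _, ?_⟩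
  · refine hbint.mono' ?_ (Filter.Eventually.of_forall fun x => ?_)
    · refine aestronglyMeasurable_of_tendsto_ae Filter.atTop
        (f := fun N x => ∑ n ∈ Finset.range N, F n x) (fun N => ?_)
        (Filter.Eventually.of_forall fun x => (hFsum x).tendsto_sum_nat)
      exact (continuous_finsetSum _ fun n _ => hFcont n).aestronglyMeasurable
    · exact (hFsum x).norm_le_of_bounded (hbsum x).hasSum fun n => hFle n x
  · have hmain := hasSum_integral_of_dominated_convergence (μ := (volume : Measure V))
      (fun n x => b n * ‖u x * v x‖) (fun n => (hFcont n).aestronglyMeasurable)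
      (fun n => Filter.Eventually.of_forall (hFle n)) (Filter.Eventually.of_forall hbsum) hbint
      (Filter.Eventually.of_forall hFsum)
    refine hmain.congr_fun fun n => ?_
    have hprod : ∀ r : Fin n → Idx × Idx, Integrable fun x =>
        (C n r : ℂ) * (u x * v x * ∏ i, toComplex (h (r i).1 (r i).2) x) := fun r => by
      refine Integrable.const_mul ?_ _
      have hbd : ∀ f : 𝓢(V, ℂ), ∃ K : ℝ, 0 ≤ K ∧ ∀ x, ‖f x‖ ≤ K := fun f => by
        obtain ⟨K, hK0, hK⟩ := f.decay 0 0
        simp only [pow_zero, one_mul, norm_iteratedFDeriv_zero] at hK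
        exact ⟨K, hK0.le, hK⟩
      choose K hK0 hK using fun i : Fin n => hbd (toComplex (h (r i).1 (r i).2))
      refine huv.mul_bdd (c := ∏ i, K i) (continuous_finsetProd _ fun i _ =>
        (toComplex _).continuous).aestronglyMeasurable (Filter.Eventually.of_forall fun x => ?_)
      rw [norm_prod]
      exact Finset.prod_le_prod (fun _ _ => norm_nonneg _) fun i _ => hK i x
    rw [integral_const_mul, integral_finsetSum _ fun r _ => hint n r]
    simp only [hterm, integral_const_mul, integral_momMeasure_prod, F, contr_graviton]
    rw [Finset.sum_congr rfl fun r _ => (integral_const_mul _ _).symm,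
      ← integral_finsetSum _ fun r _ => hprod r, ← integral_const_mul]
    congr 1
    funext x
    rw [mul_assoc, Finset.sum_mul]
    congr 1
    refine Finset.sum_congr rfl fun r _ => ?_
    ring

/-! ### Derivatives of the fields and index bookkeeping -/

/-- The partial derivative `∂_μ f` as a Schwartz function. -/
noncomputable def schwartzPd (μ : Idx) (f : 𝓢(V, ℂ)) : 𝓢(V, ℂ) :=
  ∂_{EuclideanSpace.single μ (1 : ℝ)} f

theorem schwartzPd_apply (μ : Idx) (f : 𝓢(V, ℂ)) (x : V) : schwartzPd μ f x = pd μ f x :=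
  SchwartzMap.lineDerivOp_apply_eq_fderiv _ f x

theorem schwartzPd_toComplex (μ : Idx) (f : 𝓢(V, ℝ)) (x : V) :
    schwartzPd μ (toComplex f) x = ((pd μ f x : ℝ) : ℂ) := by
  rw [schwartzPd_apply, pd, pd]
  have h : HasFDerivAt (toComplex f) (Complex.ofRealCLM.comp (fderiv ℝ f x)) x :=
    Complex.ofRealCLM.hasFDerivAt.comp x f.differentiableAt.hasFDerivAt
  rw [h.fderiv]
  rfl

theorem momSchwartz_schwartzPd (μ : Idx) (f : 𝓢(V, ℂ)) (p : V) :
    momSchwartz (schwartzPd μ f) p = Complex.I * lowerIdx p μ * momSchwartz f p :=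
  momSchwartz_lineDerivOp f μ p

theorem momSchwartz_sub (f g : 𝓢(V, ℂ)) (p : V) :
    momSchwartz (f - g) p = momSchwartz f p - momSchwartz g p := by
  have h : FourierTransform.fourier (f - g) = FourierTransform.fourier f - FourierTransform.fourier g :=
    map_sub (FourierTransform.fourierCLM ℂ 𝓢(V, ℂ)) f g
  simp [momSchwartz, h]

theorem tensorI'_comm (μ ν : Idx) {k : ℕ} (r : Fin k → Idx × Idx) :
    tensorI' μ ν r = tensorI' ν μ r := by
  unfold tensorI' tensorI
  congr 1
  refine Fintype.sum_equiv (Equiv.piCongrRight fun i : Fin (k + 1) =>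
    if i = 0 then Equiv.boolNot else Equiv.refl Bool) _ _ fun b => ?_
  congr 1
  funext i
  rw [Equiv.piCongrRight_apply, Pi.map_apply]
  refine Fin.cases ?_ (fun i => ?_) i
  · cases b 0 <;> simp
  · simp

theorem tensorCI_comm (μ ν : Idx) {n : ℕ} (r : Fin n → Idx × Idx) :
    tensorCI μ ν r = tensorCI ν μ r := by
  unfold tensorCI
  simp only [tensorI'_comm μ ν]

theorem tensorCII_comm_left (μ ν α β : Idx) {n : ℕ} (r : Fin n → Idx × Idx) :
    tensorCII μ ν α β r = tensorCII ν μ α β r := by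
  unfold tensorCII
  simp only [tensorI'_comm μ ν]

theorem tensorCII_comm_right (μ ν α β : Idx) {n : ℕ} (r : Fin n → Idx × Idx) :
    tensorCII μ ν α β r = tensorCII μ ν β α r := by
  unfold tensorCII
  simp only [tensorI'_comm α β]

section Sums

variable {ι R : Type*} [Fintype ι] [CommRing R]

theorem sum_comm_two (f : Idx → Idx → ι → R) :
    ∑ μ, ∑ ν, ∑ r, f μ ν r = ∑ r, ∑ μ, ∑ ν, f μ ν r := by
  rw [Finset.sum_congr rfl fun μ _ => Finset.sum_comm, Finset.sum_comm]

theorem sum_comm_four (f : Idx → Idx → Idx → Idx → ι → R) :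
    ∑ μ, ∑ ν, ∑ α, ∑ β, ∑ r, f μ ν α β r = ∑ r, ∑ μ, ∑ ν, ∑ α, ∑ β, f μ ν α β r := by
  simp only [fun μ ν => sum_comm_two (f μ ν)]
  exact sum_comm_two _

theorem sum_comm_six (f : Idx → Idx → Idx → Idx → Idx → Idx → ι → R) :
    ∑ μ, ∑ ν, ∑ α, ∑ β, ∑ ρ, ∑ σ, ∑ r, f μ ν α β ρ σ r =
      ∑ r, ∑ μ, ∑ ν, ∑ α, ∑ β, ∑ ρ, ∑ σ, f μ ν α β ρ σ r := by
  simp only [fun μ ν => sum_comm_four (f μ ν)]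
  exact sum_comm_two _

/-- Contracting a symmetric tensor with the symmetrization of `X ⊗ Y` or with `X ⊗ Y` is the
same. -/
theorem sum_symm_mul {C : Idx → Idx → ℂ} (hC : ∀ μ ν, C μ ν = C ν μ) (X Y : Idx → ℂ) :
    ∑ μ, ∑ ν, C μ ν * (1 / 2 * (X μ * Y ν + X ν * Y μ)) = ∑ μ, ∑ ν, C μ ν * (X μ * Y ν) := by
  have h : ∑ μ, ∑ ν, C μ ν * (X ν * Y μ) = ∑ μ, ∑ ν, C μ ν * (X μ * Y ν) := by
    rw [Finset.sum_comm]
    exact Finset.sum_congr rfl fun μ _ => Finset.sum_congr rfl fun ν _ => by rw [hC]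
  have h2 : ∀ μ ν, C μ ν * (1 / 2 * (X μ * Y ν + X ν * Y μ)) =
      1 / 2 * (C μ ν * (X μ * Y ν)) + 1 / 2 * (C μ ν * (X ν * Y μ)) := fun μ ν => by ring
  simp only [h2, Finset.sum_add_distrib, ← Finset.mul_sum, h]
  ring

/-- The same as `sum_symm_mul` in two pairs of indices at once. -/
theorem sum_symm_mul_symm {C : Idx → Idx → Idx → Idx → ℂ}
    (hC : ∀ μ ν α β, C μ ν α β = C ν μ α β) (hC' : ∀ μ ν α β, C μ ν α β = C μ ν β α)
    (X Y Z W : Idx → ℂ) :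
    ∑ μ, ∑ ν, ∑ α, ∑ β, C μ ν α β * ((1 / 2 * (X μ * Y ν + X ν * Y μ)) *
      (1 / 2 * (Z α * W β + Z β * W α))) =
    ∑ μ, ∑ ν, ∑ α, ∑ β, C μ ν α β * ((X μ * Y ν) * (Z α * W β)) := by
  have h1 : ∀ μ ν, ∑ α, ∑ β, C μ ν α β * ((1 / 2 * (X μ * Y ν + X ν * Y μ)) *
      (1 / 2 * (Z α * W β + Z β * W α))) =
      (∑ α, ∑ β, C μ ν α β * (Z α * W β)) * (1 / 2 * (X μ * Y ν + X ν * Y μ)) := fun μ ν => by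
    rw [← sum_symm_mul (hC' μ ν), Finset.sum_mul]
    refine Finset.sum_congr rfl fun α _ => ?_
    rw [Finset.sum_mul]
    exact Finset.sum_congr rfl fun β _ => by ring
  have h2 : ∀ μ ν, ∑ α, ∑ β, C μ ν α β * ((X μ * Y ν) * (Z α * W β)) =
      (∑ α, ∑ β, C μ ν α β * (Z α * W β)) * (X μ * Y ν) := fun μ ν => by
    rw [Finset.sum_mul]
    refine Finset.sum_congr rfl fun α _ => ?_
    rw [Finset.sum_mul]
    exact Finset.sum_congr rfl fun β _ => by ring
  simp only [h1, h2]
  refine sum_symm_mul (fun μ ν => ?_) X Y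
  exact Finset.sum_congr rfl fun α _ => Finset.sum_congr rfl fun β _ => by rw [hC]

end Sums

/-- Lowering an index of a complex vector. -/
noncomputable def lowerC (X : Idx → ℂ) (μ : Idx) : ℂ := ∑ l, (eta μ l : ℂ) * X l

theorem lowerC_eq (X : Idx → ℂ) (μ : Idx) : lowerC X μ = (eta μ μ : ℂ) * X μ :=
  sum_eta_mul μ X

theorem lowerC_ofReal (p : V) (μ : Idx) : lowerC (fun l => (p l : ℂ)) μ = (lowerIdx p μ : ℂ) := by
  rw [lowerC, lowerIdx]
  push_cast
  rfl

theorem eta_self_mul_self (μ : Idx) : (eta μ μ : ℂ) * eta μ μ = 1 := by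
  fin_cases μ <;> simp [eta]

theorem sum_idI_mul (μ ν : Idx) (H : Idx → Idx → ℂ) :
    ∑ ρ, ∑ σ, (idI μ ν ρ σ : ℂ) * H ρ σ =
      1 / 2 * ((eta μ μ : ℂ) * eta ν ν * (H μ ν + H ν μ)) := by
  have h : ∀ ρ σ, (idI μ ν ρ σ : ℂ) * H ρ σ =
      1 / 2 * ((eta μ ρ : ℂ) * ((eta ν σ : ℂ) * H ρ σ)) +
        1 / 2 * ((eta ν ρ : ℂ) * ((eta μ σ : ℂ) * H ρ σ)) := fun ρ σ => by
    rw [idI, eta_isSymm.apply ρ ν]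
    push_cast
    ring
  have h2 := fun (μ : Idx) (X : Idx → ℂ) => sum_eta_mul μ X
  simp only [Complex.coe_algebraMap] at h2
  simp only [h, Finset.sum_add_distrib, ← Finset.mul_sum, h2]
  ring

/-- The tensor `I_{μνρσ}` lowers both indices of `X ⊗ Y` and symmetrizes. -/
theorem sum_idI_mul_mul (μ ν : Idx) (X Y : Idx → ℂ) :
    ∑ ρ, ∑ σ, (idI μ ν ρ σ : ℂ) * (X ρ * Y σ) =
      1 / 2 * (lowerC X μ * lowerC Y ν + lowerC X ν * lowerC Y μ) := by
  rw [sum_idI_mul μ ν fun ρ σ => X ρ * Y σ]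
  simp only [lowerC_eq]
  ring

/-! ### The scalar field -/

theorem tensorTphi_eq (μ ν : Idx) (p₁ p₂ : V) : (tensorTphi μ ν p₁ p₂ : ℂ) =
    -(1 / 2) * (1 / 2 * ((lowerIdx p₁ μ : ℂ) * lowerIdx p₂ ν + lowerIdx p₁ ν * lowerIdx p₂ μ)) := by
  simp only [← lowerC_ofReal]
  rw [← sum_idI_mul_mul, tensorTphi]
  push_cast
  simp only [mul_assoc]

theorem expands_scalar {κ : ℝ} {h : Idx → Idx → 𝓢(V, ℝ)} (hs : IsSmall κ h) (φ : 𝓢(V, ℝ)) :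
    Expands (fun x => (scalarLagrangian κ h φ x : ℂ)) (scalarTerm κ h φ) := by
  refine (Expands.sum Finset.univ fun μ _ => Expands.sum Finset.univ fun ν _ =>
    ((resums_tensorCI μ ν).expands hs (schwartzPd μ (toComplex φ))
      (schwartzPd ν (toComplex φ))).const_mul (1 / 2)).congr (fun x => ?_) fun n q => ?_
  · simp only [scalarLagrangian, schwartzPd_toComplex, sqrtNegDet, invMetric, metric_eq]
    push_cast
    simp only [Finset.mul_sum]
    exact Finset.sum_congr rfl fun μ _ => Finset.sum_congr rfl fun ν _ => by ring
  · have hφ : ∀ p, momRep (fun x => (φ x : ℂ)) p = momSchwartz (toComplex φ) p := fun p =>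
      momRep_eq (toComplex φ) p
    simp only [scalarTerm, momSchwartz_schwartzPd, hφ, Finset.mul_sum]
    rw [sum_comm_two, sum_comm_two]
    refine Finset.sum_congr rfl fun r _ => ?_
    have hsym := sum_symm_mul (C := fun μ ν => (tensorCI μ ν r : ℂ))
      (fun μ ν => by rw [tensorCI_comm]) (fun μ => (lowerIdx q.1 μ : ℂ))
      (fun ν => (lowerIdx q.2.1 ν : ℂ))
    have hsym2 := congrArg (fun z => -(1 / 2) * (κ : ℂ) ^ n * gravitons h r q.2.2 *
      momSchwartz (toComplex φ) q.1 * momSchwartz (toComplex φ) q.2.1 * z) hsym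
    simp only [Finset.mul_sum] at hsym2
    refine Eq.trans ?_ (hsym2.trans ?_)
    · refine Finset.sum_congr rfl fun μ _ => Finset.sum_congr rfl fun ν _ => ?_
      rw [tensorTphi_eq]
      ring
    · refine Finset.sum_congr rfl fun μ _ => Finset.sum_congr rfl fun ν _ => ?_
      linear_combination (-(1 / 2) * (κ : ℂ) ^ n * gravitons h r q.2.2 *
        momSchwartz (toComplex φ) q.1 * momSchwartz (toComplex φ) q.2.1 * tensorCI μ ν r *
        lowerIdx q.1 μ * lowerIdx q.2.1 ν) * Complex.I_mul_I

/-! ### The vector field -/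

theorem pd_metric {κ : ℝ} {h : Idx → Idx → 𝓢(V, ℝ)} (μ α β : Idx) (x : V) :
    pd μ (fun y => metric κ h y α β) x = κ * pd μ (h α β) x := by
  have h1 : HasFDerivAt (fun y => metric κ h y α β) (κ • fderiv ℝ (h α β) x) x :=
    ((h α β).differentiableAt.hasFDerivAt.const_mul κ).const_add (eta α β)
  rw [pd, h1.fderiv]
  rfl

/-- The Christoffel symbols drop out of the field strength. -/
theorem fieldStrength_eq {κ : ℝ} {h : Idx → Idx → 𝓢(V, ℝ)} (hsymm : ∀ μ ν, h μ ν = h ν μ)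
    (A : Idx → 𝓢(V, ℝ)) (μ ν : Idx) (x : V) :
    fieldStrength κ h A μ ν x = pd μ (A ν) x - pd ν (A μ) x := by
  have hc : ∀ l, christoffel κ h l μ ν x = christoffel κ h l ν μ x := fun l => by
    simp only [christoffel, pd_metric, hsymm ν μ]
    congr 1
    refine Finset.sum_congr rfl fun β _ => ?_
    ring
  simp only [fieldStrength, covDeriv, hc]
  ring

/-- The contraction of the vertex `T^(A)` with two polarizations, in terms of covariant components. -/
theorem sum_tensorTA_mul (μ ν α β : Idx) (p₁ p₂ : V) (X Y : Idx → ℂ) :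
    ∑ l, ∑ τ, (tensorTA μ ν α β l τ p₁ p₂ : ℂ) * (X l * Y τ) = 1 / 4 * (
      1 / 2 * (lowerC X μ * lowerC Y ν + lowerC X ν * lowerC Y μ) *
        (1 / 2 * ((lowerIdx p₁ α : ℂ) * lowerIdx p₂ β + lowerIdx p₁ β * lowerIdx p₂ α)) +
      1 / 2 * ((lowerIdx p₁ μ : ℂ) * lowerIdx p₂ ν + lowerIdx p₁ ν * lowerIdx p₂ μ) *
        (1 / 2 * (lowerC X α * lowerC Y β + lowerC X β * lowerC Y α)) -
      1 / 2 * (lowerC X μ * lowerIdx p₂ ν + lowerC X ν * lowerIdx p₂ μ) *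
        (1 / 2 * (lowerIdx p₁ α * lowerC Y β + lowerIdx p₁ β * lowerC Y α)) -
      1 / 2 * (lowerIdx p₁ μ * lowerC Y ν + lowerIdx p₁ ν * lowerC Y μ) *
        (1 / 2 * (lowerC X α * lowerIdx p₂ β + lowerC X β * lowerIdx p₂ α))) := by
  simp only [← lowerC_ofReal]
  set P : Idx → ℂ := fun l => (p₁ l : ℂ) with hP
  set Q : Idx → ℂ := fun l => (p₂ l : ℂ) with hQ
  have hsplit : ∀ l τ, (tensorTA μ ν α β l τ p₁ p₂ : ℂ) * (X l * Y τ) = ∑ a, ∑ b, 1 / 4 * (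
      (idI μ ν l τ * (X l * Y τ)) * (idI α β a b * (P a * Q b)) +
      (idI μ ν a b * (P a * Q b)) * (idI α β l τ * (X l * Y τ)) -
      (idI μ ν l b * (X l * Q b)) * (idI α β τ a * (Y τ * P a)) -
      (idI μ ν a τ * (P a * Y τ)) * (idI α β l b * (X l * Q b))) := fun l τ => by
    rw [tensorTA]
    push_cast
    rw [Finset.mul_sum, Finset.sum_mul]
    refine Finset.sum_congr rfl fun a _ => ?_
    rw [Finset.mul_sum, Finset.sum_mul]
    refine Finset.sum_congr rfl fun b _ => ?_
    simp only [hP, hQ]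
    ring
  simp only [hsplit, ← Finset.mul_sum, Finset.sum_sub_distrib, Finset.sum_add_distrib,
    ← Finset.sum_mul, sum_idI_mul_mul]
  rw [Finset.sum_comm (f := fun i j => (idI μ ν j i : ℂ) * (P j * Y i))]
  simp only [sum_idI_mul_mul]
  ring

theorem lowerC_aMomUp (A : Idx → 𝓢(V, ℝ)) (μ : Idx) (p : V) :
    lowerC (fun l => aMomUp A l p) μ = momSchwartz (toComplex (A μ)) p := by
  have h1 : aMomUp A μ p = (eta μ μ : ℂ) * momRep (fun x => (A μ x : ℂ)) p :=
    sum_eta_mul μ fun σ => momRep (fun x => (A σ x : ℂ)) p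
  rw [lowerC_eq, h1, ← mul_assoc, eta_self_mul_self, one_mul]
  exact momRep_eq (toComplex (A μ)) p

/-- The symmetries `μ ↔ ν` and `α ↔ β` of `C_II` turn the symmetrized vertex into the product of the
two transformed field strengths. -/
theorem expands_vector {κ : ℝ} {h : Idx → Idx → 𝓢(V, ℝ)} (hs : IsSmall κ h)
    (hsymm : ∀ μ ν, h μ ν = h ν μ) (A : Idx → 𝓢(V, ℝ)) :
    Expands (fun x => (vectorLagrangian κ h A x : ℂ)) (vectorTerm κ h A) := by
  let F : Idx → Idx → 𝓢(V, ℂ) := fun μ α =>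
    schwartzPd μ (toComplex (A α)) - schwartzPd α (toComplex (A μ))
  have hF : ∀ μ α x, F μ α x = (fieldStrength κ h A μ α x : ℂ) := fun μ α x => by
    simp only [F, sub_apply, schwartzPd_toComplex, fieldStrength_eq hsymm]
    push_cast
    rfl
  refine (Expands.sum Finset.univ fun μ _ => Expands.sum Finset.univ fun ν _ =>
    Expands.sum Finset.univ fun α _ => Expands.sum Finset.univ fun β _ =>
    ((resums_tensorCII μ ν α β).expands hs (F μ α) (F ν β)).const_mul (-(1 / 4))).congr
      (fun x => ?_) fun n q => ?_
  · simp only [vectorLagrangian, hF, sqrtNegDet, invMetric, metric_eq]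
    push_cast
    simp only [Finset.mul_sum]
    exact Finset.sum_congr rfl fun μ _ => Finset.sum_congr rfl fun ν _ =>
      Finset.sum_congr rfl fun α _ => Finset.sum_congr rfl fun β _ => by ring
  · simp only [vectorTerm, F, momSchwartz_sub, momSchwartz_schwartzPd, Finset.mul_sum]
    rw [sum_comm_six, sum_comm_four]
    refine Finset.sum_congr rfl fun r _ => ?_
    have hsym := fun X Y Z W : Idx → ℂ => sum_symm_mul_symm
      (C := fun μ ν α β => (tensorCII μ ν α β r : ℂ))
      (fun μ ν α β => by rw [tensorCII_comm_left]) (fun μ ν α β => by rw [tensorCII_comm_right])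
      X Y Z W
    let P : Idx → ℂ := fun μ => (lowerIdx q.1 μ : ℂ)
    let Q : Idx → ℂ := fun μ => (lowerIdx q.2.1 μ : ℂ)
    let X : Idx → ℂ := fun μ => momSchwartz (toComplex (A μ)) q.1
    let Y : Idx → ℂ := fun μ => momSchwartz (toComplex (A μ)) q.2.1
    let c : ℂ := 1 / 4 * (κ : ℂ) ^ n * gravitons h r q.2.2
    have h0 : (∑ μ, ∑ ν, ∑ α, ∑ β, ∑ l, ∑ τ, (κ : ℂ) ^ n *
        ((tensorTA μ ν α β l τ q.1 q.2.1 : ℂ) * (tensorCII μ ν α β r : ℂ) * gravitons h r q.2.2 *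
          aMomUp A l q.1 * aMomUp A τ q.2.1)) =
        c * ((∑ μ, ∑ ν, ∑ α, ∑ β, (tensorCII μ ν α β r : ℂ) *
            ((1 / 2 * (X μ * Y ν + X ν * Y μ)) * (1 / 2 * (P α * Q β + P β * Q α)))) +
          (∑ μ, ∑ ν, ∑ α, ∑ β, (tensorCII μ ν α β r : ℂ) *
            ((1 / 2 * (P μ * Q ν + P ν * Q μ)) * (1 / 2 * (X α * Y β + X β * Y α)))) -
          (∑ μ, ∑ ν, ∑ α, ∑ β, (tensorCII μ ν α β r : ℂ) *
            ((1 / 2 * (X μ * Q ν + X ν * Q μ)) * (1 / 2 * (P α * Y β + P β * Y α)))) -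
          ∑ μ, ∑ ν, ∑ α, ∑ β, (tensorCII μ ν α β r : ℂ) *
            ((1 / 2 * (P μ * Y ν + P ν * Y μ)) * (1 / 2 * (X α * Q β + X β * Q α)))) := by
      simp only [← Finset.sum_add_distrib, ← Finset.sum_sub_distrib, Finset.mul_sum]
      refine Finset.sum_congr rfl fun μ _ => Finset.sum_congr rfl fun ν _ =>
        Finset.sum_congr rfl fun α _ => Finset.sum_congr rfl fun β _ => ?_
      have h1 : ∀ l τ, (κ : ℂ) ^ n * ((tensorTA μ ν α β l τ q.1 q.2.1 : ℂ) *
          (tensorCII μ ν α β r : ℂ) * gravitons h r q.2.2 * aMomUp A l q.1 * aMomUp A τ q.2.1) =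
          ((κ : ℂ) ^ n * tensorCII μ ν α β r * gravitons h r q.2.2) *
          ((tensorTA μ ν α β l τ q.1 q.2.1 : ℂ) * (aMomUp A l q.1 * aMomUp A τ q.2.1)) :=
        fun l τ => by ring
      simp only [h1, ← Finset.mul_sum]
      rw [sum_tensorTA_mul μ ν α β q.1 q.2.1 (fun l => aMomUp A l q.1) fun τ => aMomUp A τ q.2.1]
      simp only [lowerC_aMomUp, P, Q, X, Y, c]
      ring
    rw [h0, hsym X Y P Q, hsym P Q X Y, hsym X Q P Y, hsym P Y X Q]
    simp only [← Finset.sum_add_distrib, ← Finset.sum_sub_distrib, Finset.mul_sum]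
    refine Finset.sum_congr rfl fun μ _ => Finset.sum_congr rfl fun ν _ =>
      Finset.sum_congr rfl fun α _ => Finset.sum_congr rfl fun β _ => ?_
    have hI : ∀ a b : ℂ, Complex.I * a * (Complex.I * b) = -(a * b) := fun a b => by
      linear_combination a * b * Complex.I_mul_I
    have h2 : (Complex.I * P μ * X α - Complex.I * P α * X μ) *
        (Complex.I * Q ν * Y β - Complex.I * Q β * Y ν) =
        -((P μ * X α - P α * X μ) * (Q ν * Y β - Q β * Y ν)) := by
      rw [← hI]; ring
    change _ = -(1 / 4) * ((κ : ℂ) ^ n * ((tensorCII μ ν α β r : ℂ) * gravitons h r q.2.2 *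
      ((Complex.I * P μ * X α - Complex.I * P α * X μ) *
        (Complex.I * Q ν * Y β - Complex.I * Q β * Y ν))))
    rw [h2]
    simp only [c]
    ring

/-! ### The Dirac field -/

/-- The Dirac adjoint as a family of Schwartz functions. -/
noncomputable def schwartzBar (γ : Idx → Matrix Idx Idx ℂ) (ψ : Idx → 𝓢(V, ℂ)) (a : Idx) :
    𝓢(V, ℂ) :=
  ∑ b, γ 0 b a • (ψ b).postcompCLM (Complex.conjCLE : ℂ →L[ℝ] ℂ)

theorem coe_schwartzBar (γ : Idx → Matrix Idx Idx ℂ) (ψ : Idx → 𝓢(V, ℂ)) (a : Idx) :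
    diracBar γ ψ a = schwartzBar γ ψ a := by
  funext x
  rw [schwartzBar, sum_apply, diracBar]
  refine Finset.sum_congr rfl fun b _ => ?_
  rw [mul_comm]
  rfl

theorem expands_spinor {κ : ℝ} {h : Idx → Idx → 𝓢(V, ℝ)} (hs : IsSmall κ h)
    {e : V → Matrix Idx Idx ℝ} (he : IsVierbein κ h e) (γ : Idx → Matrix Idx Idx ℂ)
    (ψ : Idx → 𝓢(V, ℂ)) :
    Expands (spinorLagrangian κ h e γ ψ) (spinorTerm κ h γ ψ) := by
  have heq : ∀ x, e x = invSqrtOneAdd ((Matrix.of fun μ ν => κ * h μ ν x) * eta) := fun x => by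
    obtain ⟨θ, -, h1, hθ⟩ := hs.bound
    exact he.eq_invSqrtOneAdd ((hθ x).trans_lt h1)
  refine (Expands.sum Finset.univ fun μ _ => Expands.sum Finset.univ fun ν _ =>
    Expands.sum Finset.univ fun a _ => Expands.sum Finset.univ fun b _ =>
    (((resums_tensorCE μ ν).expands hs (schwartzBar γ ψ a) (schwartzPd ν (ψ b))).const_mul
      (Complex.I / 2 * γ μ a b)).add
    (((resums_tensorCE μ ν).expands hs (schwartzPd ν (schwartzBar γ ψ a)) (ψ b)).const_mul
      (-(Complex.I / 2 * γ μ a b)))).congr (fun x => ?_) fun n q => ?_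
  · simp only [spinorLagrangian, coe_schwartzBar, schwartzPd_apply, sqrtNegDet, metric_eq, heq]
    push_cast
    simp only [← Finset.sum_sub_distrib, Finset.mul_sum]
    exact Finset.sum_congr rfl fun μ _ => Finset.sum_congr rfl fun ν _ =>
      Finset.sum_congr rfl fun a _ => Finset.sum_congr rfl fun b _ => by ring
  · simp only [spinorTerm, coe_schwartzBar, momRep_eq, momSchwartz_schwartzPd, Finset.mul_sum,
      ← Finset.sum_add_distrib]
    refine Finset.sum_congr rfl fun μ _ => Finset.sum_congr rfl fun ν _ => ?_
    rw [sum_comm_two]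
    refine Finset.sum_congr rfl fun r _ =>
      Finset.sum_congr rfl fun a _ => Finset.sum_congr rfl fun b _ => ?_
    have hsub : lowerIdx (q.1 - q.2.1) ν = lowerIdx q.1 ν - lowerIdx q.2.1 ν := by
      rw [lowerIdx_eq, lowerIdx_eq, lowerIdx_eq, PiLp.sub_apply]
      ring
    rw [tensorTpsi, Matrix.smul_apply, hsub, smul_eq_mul]
    push_cast
    linear_combination (-(κ : ℂ) ^ n * tensorCE μ ν r * gravitons h r q.2.2 *
      momSchwartz (schwartzBar γ ψ a) q.1 * γ μ a b * momSchwartz (ψ b) q.2.1 *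
      (lowerIdx q.2.1 ν - lowerIdx q.1 ν) / 2) * Complex.I_mul_I

/-! ### The gravitational field -/

/-- The tensor `I` lowers both indices of `h` again. -/
theorem sum_idI_mul_hMomUp {h : Idx → Idx → 𝓢(V, ℝ)} (hsymm : ∀ μ ν, h μ ν = h ν μ) (α β : Idx)
    (p : V) : ∑ ρ, ∑ σ, (idI α β ρ σ : ℂ) * hMomUp h ρ σ p =
      momSchwartz (toComplex (h α β)) p := by
  have hup : ∀ ρ σ, hMomUp h ρ σ p =
      (eta ρ ρ : ℂ) * eta σ σ * momSchwartz (toComplex (h ρ σ)) p := fun ρ σ => by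
    have h2 := fun (μ : Idx) (X : Idx → ℂ) => sum_eta_mul μ X
    simp only [Complex.coe_algebraMap] at h2
    simp only [hMomUp, hMom_eq, Complex.ofReal_mul, mul_assoc, ← Finset.mul_sum, h2]
  rw [sum_idI_mul α β fun ρ σ => hMomUp h ρ σ p, hup, hup, hsymm β α]
  linear_combination (eta β β * eta β β * momSchwartz (toComplex (h α β)) p) *
    eta_self_mul_self α + momSchwartz (toComplex (h α β)) p * eta_self_mul_self β

theorem sum_six_factor (a b : Idx → ℂ) (c d : Idx → Idx → ℂ) :
    ∑ l₁, ∑ l₂, ∑ α₁, ∑ β₁, ∑ α₂, ∑ β₂, a l₁ * (b l₂ * (c α₁ β₁ * d α₂ β₂)) =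
      (∑ l, a l) * ((∑ l, b l) * ((∑ α, ∑ β, c α β) * ∑ α, ∑ β, d α β)) := by
  simp only [← Finset.mul_sum, ← Finset.sum_mul]

/-- The contraction of the vertex `T^(h)` with two momenta and two gravitons. -/
theorem sum_tensorTh_mul {h : Idx → Idx → 𝓢(V, ℝ)} (hsymm : ∀ μ ν, h μ ν = h ν μ)
    (μ ν α β ρ σ : Idx) (p₁ p₂ : V) :
    ∑ l₁, ∑ l₂, ∑ α₁, ∑ β₁, ∑ α₂, ∑ β₂, (tensorTh μ ν α β ρ σ l₁ l₂ α₁ β₁ α₂ β₂ : ℂ) *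
      ((p₁ l₁ : ℂ) * ((p₂ l₂ : ℂ) * (hMomUp h α₁ β₁ p₁ * hMomUp h α₂ β₂ p₂))) =
    -((lowerIdx p₁ μ : ℂ) * (lowerIdx p₂ ν * (momSchwartz (toComplex (h α β)) p₁ *
        momSchwartz (toComplex (h ρ σ)) p₂))) +
      (lowerIdx p₁ μ : ℂ) * (lowerIdx p₂ ν * (momSchwartz (toComplex (h α ρ)) p₁ *
        momSchwartz (toComplex (h β σ)) p₂)) -
      2 * ((lowerIdx p₁ μ : ℂ) * (lowerIdx p₂ α * (momSchwartz (toComplex (h β ρ)) p₁ *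
        momSchwartz (toComplex (h ν σ)) p₂))) +
      2 * ((lowerIdx p₁ μ : ℂ) * (lowerIdx p₂ β * (momSchwartz (toComplex (h ν α)) p₁ *
        momSchwartz (toComplex (h ρ σ)) p₂))) := by
  have hlow : ∀ (p : V) (μ : Idx), (lowerIdx p μ : ℂ) = ∑ l, (eta μ l : ℂ) * p l := fun p μ =>
    (lowerC_ofReal p μ).symm
  simp only [← sum_idI_mul_hMomUp hsymm, hlow, ← sum_six_factor]
  simp only [← Finset.sum_add_distrib, ← Finset.sum_sub_distrib, Finset.mul_sum,
    ← Finset.sum_neg_distrib]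
  refine Finset.sum_congr rfl fun l₁ _ => Finset.sum_congr rfl fun l₂ _ =>
    Finset.sum_congr rfl fun α₁ _ => Finset.sum_congr rfl fun β₁ _ =>
    Finset.sum_congr rfl fun α₂ _ => Finset.sum_congr rfl fun β₂ _ => ?_
  rw [tensorTh]
  push_cast
  ring

theorem expands_gravity {κ : ℝ} (hκ : 0 < κ) {h : Idx → Idx → 𝓢(V, ℝ)} (hs : IsSmall κ h)
    (hsymm : ∀ μ ν, h μ ν = h ν μ) :
    Expands (fun x => (gravityLagrangian κ h x : ℂ)) (gravityTerm κ h) := by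
  let D : Idx → Idx → Idx → 𝓢(V, ℂ) := fun μ α β => schwartzPd μ (toComplex (h α β))
  refine (Expands.sum Finset.univ fun μ _ => Expands.sum Finset.univ fun ν _ =>
    Expands.sum Finset.univ fun α _ => Expands.sum Finset.univ fun β _ =>
    Expands.sum Finset.univ fun ρ _ => Expands.sum Finset.univ fun σ _ =>
    ((((resums_tensorCIII μ ν α β ρ σ).expands hs (D μ α β) (D ν ρ σ)).const_mul (-(1 / 2))).add
      (((resums_tensorCIII μ ν α β ρ σ).expands hs (D μ α ρ) (D ν β σ)).const_mul (1 / 2))).add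
    ((((resums_tensorCIII μ ν α β ρ σ).expands hs (D μ β ρ) (D α ν σ)).const_mul (-1)).add
      (((resums_tensorCIII μ ν α β ρ σ).expands hs (D μ ν α) (D β ρ σ)).const_mul 1))).congr
      (fun x => ?_) fun n q => ?_
  · simp only [gravityLagrangian, D, schwartzPd_toComplex, pd_metric, sqrtNegDet, invMetric]
    simp only [metric_eq]
    push_cast
    simp only [Finset.mul_sum]
    have hκ' : (κ : ℂ) ≠ 0 := Complex.ofReal_ne_zero.2 hκ.ne'
    refine Finset.sum_congr rfl fun μ _ => Finset.sum_congr rfl fun ν _ =>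
      Finset.sum_congr rfl fun α _ => Finset.sum_congr rfl fun β _ =>
      Finset.sum_congr rfl fun ρ _ => Finset.sum_congr rfl fun σ _ => ?_
    field_simp
    ring
  · have h0 : ∀ μ₁ ν₁ μ₂ ν₂ μ₃ ν₃, (∑ l₁, ∑ l₂, ∑ α₁, ∑ β₁, ∑ α₂, ∑ β₂, ∑ r : Fin n → Idx × Idx,
        (tensorCIII μ₁ ν₁ μ₂ ν₂ μ₃ ν₃ r : ℂ) * gravitons h r q.2.2 *
          (-(1 / 2) * (tensorTh μ₁ ν₁ μ₂ ν₂ μ₃ ν₃ l₁ l₂ α₁ β₁ α₂ β₂ : ℂ)) *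
          (q.1 l₁ : ℂ) * (q.2.1 l₂ : ℂ) * hMomUp h α₁ β₁ q.1 * hMomUp h α₂ β₂ q.2.1) =
        ∑ r : Fin n → Idx × Idx, (-(1 / 2) * ((tensorCIII μ₁ ν₁ μ₂ ν₂ μ₃ ν₃ r : ℂ) *
          gravitons h r q.2.2)) * ∑ l₁, ∑ l₂, ∑ α₁, ∑ β₁, ∑ α₂, ∑ β₂,
          (tensorTh μ₁ ν₁ μ₂ ν₂ μ₃ ν₃ l₁ l₂ α₁ β₁ α₂ β₂ : ℂ) *
          ((q.1 l₁ : ℂ) * ((q.2.1 l₂ : ℂ) * (hMomUp h α₁ β₁ q.1 * hMomUp h α₂ β₂ q.2.1))) := by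
      intro μ₁ ν₁ μ₂ ν₂ μ₃ ν₃
      rw [sum_comm_six]
      simp only [Finset.mul_sum]
      refine Finset.sum_congr rfl fun r _ => Finset.sum_congr rfl fun l₁ _ =>
        Finset.sum_congr rfl fun l₂ _ => Finset.sum_congr rfl fun α₁ _ =>
        Finset.sum_congr rfl fun β₁ _ => Finset.sum_congr rfl fun α₂ _ =>
        Finset.sum_congr rfl fun β₂ _ => ?_
      ring
    simp only [gravityTerm, h0, sum_tensorTh_mul hsymm, D, momSchwartz_schwartzPd]
    simp only [Finset.mul_sum, ← Finset.sum_add_distrib]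
    refine Finset.sum_congr rfl fun μ _ => Finset.sum_congr rfl fun ν _ =>
      Finset.sum_congr rfl fun α _ => Finset.sum_congr rfl fun β _ =>
      Finset.sum_congr rfl fun ρ _ => Finset.sum_congr rfl fun σ _ =>
      Finset.sum_congr rfl fun r _ => ?_
    have hI : ∀ a b c d : ℂ, Complex.I * a * b * (Complex.I * c * d) = -(a * b * (c * d)) :=
      fun a b c d => by linear_combination a * b * c * d * Complex.I_mul_I
    simp only [hI]
    ring

/-! ### Real actions -/

theorem Expands.of_real {L : V → ℝ} {T : ∀ n, Momenta n → ℂ}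
    (h : Expands (fun x => (L x : ℂ)) T) :
    Integrable L ∧ (∀ n, Integrable (T n) (momMeasure n)) ∧
      HasSum (fun n => ∫ q, T n q ∂(momMeasure n)) ((∫ x, L x : ℝ) : ℂ) := by
  refine ⟨?_, h.integrable_term, ?_⟩
  · simpa using h.integrable.re
  · have e : ((∫ x, L x : ℝ) : ℂ) = ∫ x, (L x : ℂ) := integral_ofReal.symm
    rw [e]
    exact h.hasSum

theorem isSmall_of_row_sums {κ : ℝ} (hκ : 0 < κ) {h : Idx → Idx → 𝓢(V, ℝ)}
    (hsymm : ∀ μ ν, h μ ν = h ν μ) (hsmall : ∀ x μ, κ * ∑ ν, |h μ ν x| < 1) : IsSmall κ h where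
  isSymm x := Matrix.IsSymm.ext fun μ ν => by simp only [Matrix.of_apply, hsymm μ ν]
  bound := exists_uniform_bound hκ hsmall

theorem exists_isVierbein {κ : ℝ} {h : Idx → Idx → 𝓢(V, ℝ)} (hs : IsSmall κ h) :
    ∃ e, IsVierbein κ h e := by
  obtain ⟨θ, -, h1, hθ⟩ := hs.bound
  exact ⟨_, isVierbein_invSqrtOneAdd hs.isSymm fun x => (hθ x).trans_lt h1⟩

end FeynGrav

theorem theorem7 (κ : ℝ) (hκ : 0 < κ)
    (h : Idx → Idx → 𝓢(V, ℝ)) (hsymm : ∀ μ ν, h μ ν = h ν μ)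
    (hsmall : ∀ x μ, κ * ∑ ν, |h μ ν x| < 1) :
    -- scalar field
    (∀ φ : 𝓢(V, ℝ),
      MeasureTheory.Integrable (scalarLagrangian κ h φ) ∧
      (∀ n, MeasureTheory.Integrable (scalarTerm κ h φ n) (momMeasure n)) ∧
      HasSum (fun n => ∫ q, scalarTerm κ h φ n q ∂(momMeasure n)) (scalarAction κ h φ : ℂ)) ∧
    -- vector field
    (∀ A : Idx → 𝓢(V, ℝ),
      MeasureTheory.Integrable (vectorLagrangian κ h A) ∧
      (∀ n, MeasureTheory.Integrable (vectorTerm κ h A n) (momMeasure n)) ∧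
      HasSum (fun n => ∫ q, vectorTerm κ h A n q ∂(momMeasure n)) (vectorAction κ h A : ℂ)) ∧
    -- Dirac spinor field
    ((∃ e, IsVierbein κ h e) ∧
      ∀ e : V → Matrix Idx Idx ℝ, IsVierbein κ h e →
      ∀ γ : Idx → Matrix Idx Idx ℂ, IsDirac γ → ∀ ψ : Idx → 𝓢(V, ℂ),
      MeasureTheory.Integrable (spinorLagrangian κ h e γ ψ) ∧
      (∀ n, MeasureTheory.Integrable (spinorTerm κ h γ ψ n) (momMeasure n)) ∧
      HasSum (fun n => ∫ q, spinorTerm κ h γ ψ n q ∂(momMeasure n)) (spinorAction κ h e γ ψ)) ∧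
    -- gravity in the Einstein parameterization
    (MeasureTheory.Integrable (gravityLagrangian κ h) ∧
      (∀ n, MeasureTheory.Integrable (gravityTerm κ h n) (momMeasure n)) ∧
      HasSum (fun n => ∫ q, gravityTerm κ h n q ∂(momMeasure n)) (gravityAction κ h : ℂ)) := by
  have hs := isSmall_of_row_sums hκ hsymm hsmall
  exact ⟨fun φ => (expands_scalar hs φ).of_real, fun A => (expands_vector hs hsymm A).of_real,
    ⟨exists_isVierbein hs, fun e he γ _ ψ =>
      have hψ := expands_spinor hs he γ ψ
      ⟨hψ.integrable, hψ.integrable_term, hψ.hasSum⟩⟩,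
    (expands_gravity hκ hs hsymm).of_real⟩
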